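/- **Setting.** Let $A$ be Lebesgue area measure on $\mathbb C$. Let $\mathscr P(\mathbb C)$ be the set of measurable $p:\mathbb C\to[1,\infty)$ with $p^+=\operatorname{ess\,sup}_{z\in\mathbb C}p(z)<\infty$. For a measurable $q:\mathbb C\to[1,\infty]$ put $$C_{q(\cdot)}=\int_{\mathbb C}e^{-|z|^2q(z)}\,dA(z),\qquad \rho_{q(\cdot)}(f)=C_{q(\cdot)}^{-1}\int_{\mathbb C}\bigl(|f(z)|e^{-|z|^2}\bigr)^{q(z)}\,dA(z),$$ where $t^{\infty}=0$ for $0\le t\le 1$ and $t^{\infty}=\infty$ for $t>1$ (if $q=\infty$ a.e., then $C_{q(\cdot)}=0$, the integral is $0$ or $\infty$, and the factor $C_{q(\cdot)}^{-1}$ is omitted). Let $\mathcal L^{q(\cdot)}$ be the space of measurable $f:\mathbb C\to\mathbb C$, modulo equality a.e., with $\rho_{q(\cdot)}(tf)<\infty$ for some $t>0$, with the Luxemburg–Nakano norm $$\|f\|_{\mathcal L^{q(\cdot)}}=\inf\{\lambda>0:\rho_{q(\cdot)}(f/\lambda)\le 1\}.$$ **Theorem.** Let $p\in\mathscr P(\mathbb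 C)$ and let $p':\mathbb C\to[1,\infty]$ satisfy $\frac1{p(z)}+\frac1{p'(z)}=1$ for all $z\in\mathbb C$ (with $\frac1\infty=0$). Then the dual space $(\mathcal L^{p(\cdot)})^*$ is isomorphic, by a bounded complex-linear bijection with bounded inverse, to $\mathcal L^{p'(\cdot)}$. Moreover, for all $f\in\mathcal L^{p(\cdot)}$ and $h\in\mathcal L^{p'(\cdot)}$ the function $f\,\overline h\,e^{-2|\cdot|^2}$ is integrable, and $$\Lambda_h(f)=\frac2\pi\int_{\mathbb C}f(z)\overline{h(z)}e^{-2|z|^2}\,dA(z)$$ defines a conjugate-linear homeomorphic bijection $h\mapsto\Lambda_h$ from $\mathcal L^{p'(\cdot)}$ onto $(\mathcal L^{p(\cdot)})^*$; in particular, every bounded linear functional on $\mathcal L^{p(\cdot)}$ is $\Lambda_h$ for exactly one $h\in\mathcal L^{p'(\cdot)}$. There are constants $c,C>0$, not depending on $h$, such that $$c\,\|h\|_{\mathcal L^{p'(\cdot)}}\le\|\Lambda_h\|\le C\,\|h\|_{\mathcal L^{p'(\cdot)}}\qquad\text{for all }h\in\mathcal L^{p'(\cdot)}.$$ -/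

import Mathlib

open MeasureTheory ENNReal

noncomputable section

/-- An extended variable exponent: a measurable function `q : ℂ → [1, ∞]`. -/
structure VariableExponent where
  toFun : ℂ → ℝ≥0∞
  measurable_toFun : Measurable toFun
  one_le : ∀ z, 1 ≤ toFun z

namespace VariableExponent

instance : CoeFun VariableExponent (fun _ => ℂ → ℝ≥0∞) := ⟨toFun⟩

/-- The class `𝒫(ℂ)`: the exponents with values in `[1, ∞)` whose essential supremum is finite. -/
def IsBounded (p : VariableExponent) : Prop :=
  (∀ z, p z < ∞) ∧ essSup p volume < ∞

/-- `t ^ q`, where `t ^ ∞` is read as `0` if `t ≤ 1` and as `∞` if `t > 1`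
(the usual convention for variable exponents that attain the value `∞`). -/
def power (q t : ℝ≥0∞) : ℝ≥0∞ :=
  if q = ∞ then (if t ≤ 1 then 0 else ∞) else t ^ q.toReal

/-- The unnormalized Gaussian modular
`∫ (|f(z)| e^{-|z|²})^{q(z)} dA(z) = ∫ |f(z)|^{q(z)} e^{-|z|² q(z)} dA(z)`. -/
def rawModular (q : VariableExponent) (f : ℂ → ℂ) : ℝ≥0∞ :=
  ∫⁻ z, power (q z) (‖f z‖ₑ * ENNReal.ofReal (Real.exp (-‖z‖ ^ 2)))

/-- The normalizing constant `C_q = ∫ e^{-|z|² q(z)} dA(z)`. -/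
def gaussConst (q : VariableExponent) : ℝ≥0∞ :=
  ∫⁻ z, power (q z) (ENNReal.ofReal (Real.exp (-‖z‖ ^ 2)))

/-- The normalized modular `ρ_q(f) = C_q⁻¹ ∫ |f(z)|^{q(z)} e^{-|z|² q(z)} dA(z)`.
(If `q = ∞` almost everywhere, then `C_q = 0`, the integral is `0` or `∞`, and the
factor `C_q⁻¹ = ∞` does not change it.) -/
def modular (q : VariableExponent) (f : ℂ → ℂ) : ℝ≥0∞ :=
  (gaussConst q)⁻¹ * rawModular q f

/-- The Luxemburg-Nakano norm `inf {t > 0 : ρ_q(f / t) ≤ 1}`. -/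
def luxNorm (q : VariableExponent) (f : ℂ → ℂ) : ℝ :=
  sInf {t : ℝ | 0 < t ∧ modular q (fun z => f z / (t : ℂ)) ≤ 1}

lemma power_zero {q : ℝ≥0∞} (hq : 1 ≤ q) : power q 0 = 0 := by
  unfold power
  split_ifs with h h1
  · rfl
  · exact absurd zero_le_one h1
  · exact ENNReal.zero_rpow_of_pos
      (ENNReal.toReal_pos (zero_lt_one.trans_le hq).ne' h)

lemma power_mono {q s t : ℝ≥0∞} (hst : s ≤ t) : power q s ≤ power q t := by
  unfold power
  split_ifs with h h1 h2 h2
  · exact le_rfl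
  · exact zero_le
  · exact absurd (hst.trans h2) h1
  · exact le_rfl
  · exact ENNReal.rpow_le_rpow hst ENNReal.toReal_nonneg

lemma power_convex {q : ℝ≥0∞} (hq : 1 ≤ q) {a b : ℝ≥0∞} (hab : a + b = 1) (s t : ℝ≥0∞) :
    power q (a * s + b * t) ≤ a * power q s + b * power q t := by
  by_cases ha : a = 0
  · subst ha
    simp only [zero_add] at hab
    simp [hab]
  by_cases hb : b = 0
  · subst hb
    simp only [add_zero] at hab
    simp [hab]
  unfold power
  by_cases h : q = ∞
  · simp only [h, if_true]
    by_cases hs : s ≤ 1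
    · by_cases ht : t ≤ 1
      · have : a * s + b * t ≤ 1 := by
          calc a * s + b * t ≤ a * 1 + b * 1 := by gcongr
            _ = 1 := by simp [hab]
        simp [this]
      · simp [ht, ENNReal.mul_top hb]
    · simp [hs, ENNReal.mul_top ha]
  · simp only [h, if_false]
    refine ENNReal.rpow_arith_mean_le_arith_mean2_rpow a b s t hab ?_
    rw [← ENNReal.toReal_one]
    exact ENNReal.toReal_mono h hq

lemma eq_zero_of_power {q : ℝ≥0∞} (hq : 1 ≤ q) {t : ℝ≥0∞}
    (h : ∀ n : ℕ, power q ((n : ℝ≥0∞) * t) = 0) : t = 0 := by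
  by_contra ht
  by_cases hqt : q = ∞
  · obtain ⟨n, hn⟩ : ∃ n : ℕ, 1 < (n : ℝ≥0∞) * t := by
      by_cases htt : t = ∞
      · exact ⟨1, by simp [htt]⟩
      · obtain ⟨n, hn⟩ := ENNReal.exists_nat_gt (ENNReal.inv_ne_top.2 ht)
        refine ⟨n, ?_⟩
        rw [← ENNReal.inv_mul_cancel ht htt]
        exact ENNReal.mul_lt_mul_left ht htt hn
    have := h n
    simp [power, hqt, not_le.2 hn] at this
  · have := h 1
    have hpos := ENNReal.toReal_pos (zero_lt_one.trans_le hq).ne' hqt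
    simp [power, hqt, ENNReal.rpow_eq_zero_iff, ht, not_lt.2 hpos.le] at this

lemma aemeasurable_integrand (q : VariableExponent) {f : ℂ → ℂ}
    (hf : AEStronglyMeasurable f volume) :
    AEMeasurable (fun z => power (q z)
      (‖f z‖ₑ * ENNReal.ofReal (Real.exp (-‖z‖ ^ 2)))) volume := by
  have hpow : Measurable (fun x : ℝ≥0∞ × ℝ≥0∞ => power x.1 x.2) := by
    unfold power
    refine Measurable.ite (measurable_fst (measurableSet_singleton _)) ?_ ?_
    · exact Measurable.ite (measurableSet_le measurable_snd measurable_const)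
        measurable_const measurable_const
    · exact measurable_snd.pow measurable_fst.ennreal_toReal
  have hw : Measurable (fun z : ℂ => ENNReal.ofReal (Real.exp (-‖z‖ ^ 2))) := by fun_prop
  exact hpow.comp_aemeasurable
    (q.measurable_toFun.aemeasurable.prodMk (hf.enorm.mul hw.aemeasurable))

lemma modular_congr (q : VariableExponent) {f g : ℂ → ℂ} (h : f =ᵐ[volume] g) :
    modular q f = modular q g := by
  unfold modular rawModular
  congr 1
  refine lintegral_congr_ae ?_
  filter_upwards [h] with z hz
  rw [hz]

lemma modular_zero (q : VariableExponent) : modular q (fun _ => 0) = 0 := by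
  simp [modular, rawModular, power_zero (q.one_le _)]

lemma modular_mono (q : VariableExponent) {f g : ℂ → ℂ} (h : ∀ z, ‖f z‖ ≤ ‖g z‖) :
    modular q f ≤ modular q g := by
  unfold modular rawModular
  gcongr
  refine power_mono ?_
  gcongr
  exact enorm_le_iff_norm_le.2 (h _)

/-- Convexity of the modular. -/
lemma modular_convex (q : VariableExponent) {f g : ℂ → ℂ}
    (hf : AEStronglyMeasurable f volume)
    {a b : ℝ} (ha : 0 ≤ a) (hb : 0 ≤ b) (hab : a + b = 1) :
    modular q (fun z => (a : ℂ) * f z + (b : ℂ) * g z) ≤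
      ENNReal.ofReal a * modular q f + ENNReal.ofReal b * modular q g := by
  have hab' : ENNReal.ofReal a + ENNReal.ofReal b = 1 := by
    rw [← ENNReal.ofReal_add ha hb, hab, ENNReal.ofReal_one]
  have key : rawModular q (fun z => (a : ℂ) * f z + (b : ℂ) * g z) ≤
      ENNReal.ofReal a * rawModular q f + ENNReal.ofReal b * rawModular q g := by
    unfold rawModular
    rw [← lintegral_const_mul' _ _ ENNReal.ofReal_ne_top,
      ← lintegral_const_mul' _ _ ENNReal.ofReal_ne_top,
      ← lintegral_add_left' ((aemeasurable_integrand q hf).const_mul _)]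
    refine lintegral_mono fun z => ?_
    refine le_trans (power_mono ?_) (power_convex (q.one_le z) hab' _ _)
    rw [← mul_assoc, ← mul_assoc, ← add_mul]
    gcongr
    refine (enorm_add_le _ _).trans (le_of_eq ?_)
    rw [enorm_mul, enorm_mul]
    congr 2
    · rw [← ofReal_norm, Complex.norm_real, Real.norm_of_nonneg ha]
    · rw [← ofReal_norm, Complex.norm_real, Real.norm_of_nonneg hb]
  unfold modular
  calc _ ≤ (gaussConst q)⁻¹ *
        (ENNReal.ofReal a * rawModular q f + ENNReal.ofReal b * rawModular q g) := by gcongr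
    _ = _ := by ring

lemma modular_scale (q : VariableExponent) {f : ℂ → ℂ}
    (hf : AEStronglyMeasurable f volume) {a : ℝ} (ha : 0 ≤ a) (ha1 : a ≤ 1) :
    modular q (fun z => (a : ℂ) * f z) ≤ ENNReal.ofReal a * modular q f := by
  have := modular_convex q (g := fun _ => 0) hf ha (sub_nonneg.2 ha1) (by ring)
  simpa [modular_zero] using this

lemma gaussConst_ne_top (q : VariableExponent) : gaussConst q ≠ ∞ := by
  have hint : Integrable (fun z : ℂ => Real.exp (-‖z‖ ^ 2)) volume := by
    have h := (GaussianFourier.integrable_cexp_neg_mul_sq_norm_add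
      (b := 1) (by simp) 0 (0 : ℂ)).norm
    refine h.congr (Filter.Eventually.of_forall fun z => ?_)
    have e : (-1 * (‖z‖ : ℂ) ^ 2 + 0 * (inner ℝ (0 : ℂ) z : ℂ)) = ((-‖z‖ ^ 2 : ℝ) : ℂ) := by
      push_cast; ring
    simp only [e, Complex.norm_exp_ofReal]
  refine ne_top_of_le_ne_top (hint.lintegral_lt_top).ne (lintegral_mono fun z => ?_)
  have h1 : ENNReal.ofReal (Real.exp (-‖z‖ ^ 2)) ≤ 1 := by
    rw [← ENNReal.ofReal_one]
    exact ENNReal.ofReal_le_ofReal (Real.exp_le_one_iff.2 (by nlinarith [norm_nonneg z]))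
  unfold power
  split_ifs with h
  · exact zero_le
  · have hq1 : 1 ≤ (q z).toReal := by
      rw [← ENNReal.toReal_one]
      exact ENNReal.toReal_mono h (q.one_le z)
    simpa using ENNReal.rpow_le_rpow_of_exponent_ge h1 hq1

end VariableExponent

open VariableExponent

/-- The space `𝓛^{q(·)}` of (classes modulo null sets of) measurable functions `f : ℂ → ℂ` with
`ρ_q(t f) < ∞` for some `t > 0`. -/
def GaussianLp (q : VariableExponent) : Submodule ℂ (ℂ →ₘ[(volume : Measure ℂ)] ℂ) where
  carrier := {f | ∃ t : ℝ, 0 < t ∧ modular q (fun z => (t : ℂ) * f z) < ∞}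
  zero_mem' := by
    refine ⟨1, one_pos, ?_⟩
    rw [modular_congr q (g := fun _ => 0), modular_zero]
    · simp
    · filter_upwards [AEEqFun.coeFn_zero (α := ℂ) (β := ℂ) (μ := volume)] with z hz
      simp [hz]
  add_mem' := by
    rintro f g ⟨s, hs, hf⟩ ⟨t, ht, hg⟩
    have hst : 0 < s + t := add_pos hs ht
    refine ⟨s * t / (s + t), by positivity, ?_⟩
    have hst' : (s : ℂ) + (t : ℂ) ≠ 0 := by exact_mod_cast hst.ne'
    rw [modular_congr q (g := fun z => ((t / (s + t) : ℝ) : ℂ) * ((s : ℂ) * f z)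
      + ((s / (s + t) : ℝ) : ℂ) * ((t : ℂ) * g z))]
    · refine (modular_convex q (f.aestronglyMeasurable.const_mul _)
        (by positivity) (by positivity) (by field_simp; ring)).trans_lt ?_
      exact ENNReal.add_lt_top.2 ⟨ENNReal.mul_lt_top ENNReal.ofReal_lt_top hf,
        ENNReal.mul_lt_top ENNReal.ofReal_lt_top hg⟩
    · filter_upwards [AEEqFun.coeFn_add f g] with z hz
      rw [hz]
      push_cast
      simp only [Pi.add_apply]
      field_simp
  smul_mem' := by
    rintro c f ⟨t, ht, hf⟩
    refine ⟨t / (‖c‖ + 1), by positivity, lt_of_le_of_lt ?_ hf⟩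
    rw [modular_congr q (g := fun z => ((t / (‖c‖ + 1) : ℝ) : ℂ) * (c * f z))]
    · refine modular_mono q fun z => ?_
      have hc : 0 < ‖c‖ + 1 := by positivity
      rw [norm_mul, norm_mul, norm_mul, Complex.norm_real, Complex.norm_real,
        Real.norm_of_nonneg (by positivity), Real.norm_of_nonneg ht.le, div_mul_eq_mul_div,
        div_le_iff₀ hc]
      have : 0 ≤ t * ‖f z‖ := by positivity
      nlinarith
    · filter_upwards [AEEqFun.coeFn_smul c f] with z hz
      rw [hz]
      simp

namespace GaussianLp

variable {q : VariableExponent}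

/-- The norm of `𝓛^{q(·)}` is the Luxemburg-Nakano norm of the normalized modular. -/
instance : Norm (GaussianLp q) := ⟨fun f => luxNorm q (f : ℂ →ₘ[volume] ℂ)⟩

lemma norm_def (f : GaussianLp q) : ‖f‖ = luxNorm q (f : ℂ →ₘ[volume] ℂ) := rfl

lemma bddBelow_luxSet (f : ℂ → ℂ) :
    BddBelow {t : ℝ | 0 < t ∧ modular q (fun z => f z / (t : ℂ)) ≤ 1} :=
  ⟨0, fun _ ht => ht.1.le⟩

lemma luxNorm_nonneg (f : ℂ → ℂ) : 0 ≤ luxNorm q f :=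
  Real.sInf_nonneg fun _ ht => ht.1.le

lemma nonempty_luxSet (f : GaussianLp q) :
    {t : ℝ | 0 < t ∧ modular q
      (fun z => (f : ℂ →ₘ[volume] ℂ) z / (t : ℂ)) ≤ 1}.Nonempty := by
  obtain ⟨t, ht, hf⟩ := f.2
  set M := (modular q (fun z => (t : ℂ) * (f : ℂ →ₘ[volume] ℂ) z)).toReal with hM
  have hM0 : 0 ≤ M := ENNReal.toReal_nonneg
  have hM1 : 0 < M + 1 := by positivity
  refine ⟨(M + 1) / t, by positivity, ?_⟩
  have h := modular_scale q (f := fun z => (t : ℂ) * (f : ℂ →ₘ[volume] ℂ) z)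
    ((f : ℂ →ₘ[volume] ℂ).aestronglyMeasurable.const_mul _) (a := 1 / (M + 1))
    (by positivity) (by rw [div_le_one hM1]; linarith)
  have e : (fun z => (f : ℂ →ₘ[volume] ℂ) z / (((M + 1) / t : ℝ) : ℂ)) =
      fun z => ((1 / (M + 1) : ℝ) : ℂ) * ((t : ℂ) * (f : ℂ →ₘ[volume] ℂ) z) := by
    funext z
    have h1 : (t : ℂ) ≠ 0 := by exact_mod_cast ht.ne'
    have h2 : (M : ℂ) + 1 ≠ 0 := by exact_mod_cast hM1.ne'
    push_cast
    field_simp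
  rw [e]
  refine h.trans ?_
  rw [← ENNReal.ofReal_toReal hf.ne, ← hM, ← ENNReal.ofReal_mul (by positivity),
    ← ENNReal.ofReal_one]
  refine ENNReal.ofReal_le_ofReal ?_
  rw [one_div, inv_mul_le_iff₀ hM1]
  linarith

/-- Every `t` above the norm is admissible in its definition. -/
lemma modular_le_one_of_lt (f : GaussianLp q) {t : ℝ} (h : ‖f‖ < t) :
    modular q (fun z => (f : ℂ →ₘ[volume] ℂ) z / (t : ℂ)) ≤ 1 := by
  obtain ⟨s, ⟨hs, hs1⟩, hst⟩ := exists_lt_of_csInf_lt (nonempty_luxSet f) h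
  refine (modular_mono q fun z => ?_).trans hs1
  rw [norm_div, norm_div, Complex.norm_real, Complex.norm_real, Real.norm_of_nonneg hs.le,
    Real.norm_of_nonneg (hs.trans hst).le]
  gcongr

lemma norm_le_of_modular (f : GaussianLp q) {t : ℝ} (ht : 0 < t)
    (h : modular q (fun z => (f : ℂ →ₘ[volume] ℂ) z / (t : ℂ)) ≤ 1) : ‖f‖ ≤ t :=
  csInf_le (bddBelow_luxSet _) ⟨ht, h⟩

lemma norm_add_le' (f g : GaussianLp q) : ‖f + g‖ ≤ ‖f‖ + ‖g‖ := by
  refine le_of_forall_pos_le_add fun ε hε => ?_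
  have hf0 : 0 ≤ ‖f‖ := luxNorm_nonneg _
  have hg0 : 0 ≤ ‖g‖ := luxNorm_nonneg _
  set s := ‖f‖ + ε / 2 with hs
  set t := ‖g‖ + ε / 2 with ht
  have hs0 : 0 < s := by positivity
  have ht0 : 0 < t := by positivity
  have hst : 0 < s + t := add_pos hs0 ht0
  have e : ‖f‖ + ‖g‖ + ε = s + t := by rw [hs, ht]; ring
  rw [e]
  refine norm_le_of_modular _ hst ?_
  have h1 := modular_le_one_of_lt f (t := s) (by linarith)
  have h2 := modular_le_one_of_lt g (t := t) (by linarith)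
  have hsC : (s : ℂ) ≠ 0 := by exact_mod_cast hs0.ne'
  have htC : (t : ℂ) ≠ 0 := by exact_mod_cast ht0.ne'
  have hstC : (s : ℂ) + (t : ℂ) ≠ 0 := by exact_mod_cast hst.ne'
  rw [modular_congr q (g := fun z =>
    ((s / (s + t) : ℝ) : ℂ) * ((f : ℂ →ₘ[volume] ℂ) z / (s : ℂ))
      + ((t / (s + t) : ℝ) : ℂ) * ((g : ℂ →ₘ[volume] ℂ) z / (t : ℂ)))]
  · have hm : AEStronglyMeasurable
        (fun z => (f : ℂ →ₘ[volume] ℂ) z / (s : ℂ)) volume := by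
      simpa only [div_eq_mul_inv] using
        (f : ℂ →ₘ[volume] ℂ).aestronglyMeasurable.mul_const ((s : ℂ)⁻¹)
    have hsum : s / (s + t) + t / (s + t) = 1 := by field_simp
    refine (modular_convex q hm (by positivity) (by positivity) hsum).trans ?_
    calc _ ≤ ENNReal.ofReal (s / (s + t)) * 1 + ENNReal.ofReal (t / (s + t)) * 1 := by gcongr
      _ = 1 := by
        rw [mul_one, mul_one, ← ENNReal.ofReal_add (by positivity) (by positivity), hsum,
          ENNReal.ofReal_one]
  · filter_upwards [AEEqFun.coeFn_add (f : ℂ →ₘ[volume] ℂ) (g : ℂ →ₘ[volume] ℂ)] with z hz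
    rw [Submodule.coe_add, hz]
    push_cast
    simp only [Pi.add_apply]
    field_simp

lemma norm_smul_le' (c : ℂ) (f : GaussianLp q) : ‖c • f‖ ≤ ‖c‖ * ‖f‖ := by
  have hf0 : 0 ≤ ‖f‖ := luxNorm_nonneg _
  have hc0 : 0 ≤ ‖c‖ := norm_nonneg c
  have key : ∀ ε : ℝ, 0 < ε → ‖c • f‖ ≤ (‖c‖ + ε) * (‖f‖ + ε) := fun ε hε => by
    refine norm_le_of_modular _ (by positivity) ?_
    refine le_trans ?_ (modular_le_one_of_lt f (t := ‖f‖ + ε) (by linarith))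
    rw [modular_congr q (g := fun z => c * (f : ℂ →ₘ[volume] ℂ) z /
      (((‖c‖ + ε) * (‖f‖ + ε) : ℝ) : ℂ))]
    · refine modular_mono q fun z => ?_
      rw [norm_div, norm_div, norm_mul, Complex.norm_real, Complex.norm_real,
        Real.norm_of_nonneg (by positivity), Real.norm_of_nonneg (by positivity),
        mul_div_mul_comm]
      refine mul_le_of_le_one_left (by positivity) ?_
      rw [div_le_one (by positivity)]
      linarith
    · filter_upwards [AEEqFun.coeFn_smul c (f : ℂ →ₘ[volume] ℂ)] with z hz
      rw [Submodule.coe_smul, hz]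
      simp
  have hcont : Filter.Tendsto (fun ε : ℝ => (‖c‖ + ε) * (‖f‖ + ε))
      (nhdsWithin 0 (Set.Ioi 0)) (nhds (‖c‖ * ‖f‖)) := by
    have : Continuous fun ε : ℝ => (‖c‖ + ε) * (‖f‖ + ε) := by fun_prop
    simpa using (this.tendsto 0).mono_left nhdsWithin_le_nhds
  exact ge_of_tendsto hcont (Filter.eventually_of_mem self_mem_nhdsWithin key)

lemma norm_zero' : ‖(0 : GaussianLp q)‖ = 0 := by
  refine le_antisymm ?_ (luxNorm_nonneg _)
  simpa using norm_smul_le' (0 : ℂ) (0 : GaussianLp q)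

lemma norm_smul' (c : ℂ) (f : GaussianLp q) : ‖c • f‖ = ‖c‖ * ‖f‖ := by
  refine le_antisymm (norm_smul_le' c f) ?_
  by_cases hc : c = 0
  · simp [hc, norm_zero']
  · have h := norm_smul_le' c⁻¹ (c • f)
    rw [smul_smul, inv_mul_cancel₀ hc, one_smul, norm_inv] at h
    rwa [← le_inv_mul_iff₀ (norm_pos_iff.2 hc)]

lemma eq_zero_of_norm (f : GaussianLp q) (hf : ‖f‖ = 0) : f = 0 := by
  have hmeas := (f : ℂ →ₘ[volume] ℂ).aestronglyMeasurable
  have hzero : ∀ n : ℕ, modular q (fun z => (n : ℂ) * (f : ℂ →ₘ[volume] ℂ) z) = 0 := by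
    intro n
    have hε : ∀ ε : ℝ, 0 < ε → ε ≤ 1 →
        modular q (fun z => (n : ℂ) * (f : ℂ →ₘ[volume] ℂ) z) ≤ ENNReal.ofReal ε := by
      intro ε hε hε1
      have hn : (0 : ℝ) < (n : ℝ) + 1 := by positivity
      have h1 := modular_le_one_of_lt f (t := ε / ((n : ℝ) + 1)) (by rw [hf]; positivity)
      have hm : AEStronglyMeasurable (fun z =>
          (f : ℂ →ₘ[volume] ℂ) z / ((ε / ((n : ℝ) + 1) : ℝ) : ℂ)) volume := by
        simpa only [div_eq_mul_inv] using hmeas.mul_const _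
      have h2 := modular_scale q hm hε.le hε1
      refine le_trans (modular_mono q fun z => ?_)
        (h2.trans (mul_le_of_le_one_right' h1))
      rw [norm_mul, norm_mul, norm_div, Complex.norm_real, Complex.norm_real,
        Complex.norm_natCast, Real.norm_of_nonneg hε.le, Real.norm_of_nonneg (by positivity)]
      have e : ε * (‖(f : ℂ →ₘ[volume] ℂ) z‖ / (ε / ((n : ℝ) + 1))) =
          ((n : ℝ) + 1) * ‖(f : ℂ →ₘ[volume] ℂ) z‖ := by field_simp
      rw [e]
      gcongr
      linarith
    have hlim : Filter.Tendsto (fun ε : ℝ => ENNReal.ofReal ε)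
        (nhdsWithin 0 (Set.Ioi 0)) (nhds 0) := by
      simpa using (ENNReal.continuous_ofReal.tendsto 0).mono_left nhdsWithin_le_nhds
    refine le_antisymm (ge_of_tendsto hlim ?_) zero_le
    filter_upwards [Ioc_mem_nhdsGT (zero_lt_one (α := ℝ))] with ε h
    exact hε ε h.1 h.2
  have hae : ∀ n : ℕ, ∀ᵐ z : ℂ, power (q z) (‖(n : ℂ) * (f : ℂ →ₘ[volume] ℂ) z‖ₑ *
      ENNReal.ofReal (Real.exp (-‖z‖ ^ 2))) = 0 := by
    intro n
    have h := hzero n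
    rw [modular, mul_eq_zero] at h
    have h' := h.resolve_left (ENNReal.inv_ne_zero.2 (gaussConst_ne_top q))
    exact (lintegral_eq_zero_iff' (aemeasurable_integrand q (hmeas.const_mul _))).1 h'
  have hfz : (f : ℂ →ₘ[volume] ℂ) = 0 := by
    refine AEEqFun.ext ?_
    filter_upwards [ae_all_iff.2 hae, AEEqFun.coeFn_zero (α := ℂ) (β := ℂ) (μ := volume)]
      with z hz h0
    rw [h0]
    have := eq_zero_of_power (q.one_le z) (t := ‖(f : ℂ →ₘ[volume] ℂ) z‖ₑ *
      ENNReal.ofReal (Real.exp (-‖z‖ ^ 2))) fun n => by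
        have := hz n
        rwa [enorm_mul, mul_assoc, ← ofReal_norm (n : ℂ), Complex.norm_natCast,
          ENNReal.ofReal_natCast] at this
    rcases mul_eq_zero.1 this with h | h
    · simpa using h
    · exact absurd h (by simp [Real.exp_pos])
  exact Subtype.ext hfz

lemma core (q : VariableExponent) : NormedSpace.Core ℂ (GaussianLp q) where
  norm_nonneg _ := luxNorm_nonneg _
  norm_smul := norm_smul'
  norm_triangle := norm_add_le'
  norm_eq_zero_iff f := ⟨eq_zero_of_norm f, fun h => by rw [h, norm_zero']⟩

instance : NormedAddCommGroup (GaussianLp q) := NormedAddCommGroup.ofCore (core q)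

instance : NormedSpace ℂ (GaussianLp q) := NormedSpace.ofCore (core q)

end GaussianLp

end

/-! Everything rests on the bilinear pairing $\frac2\pi\int fh\,e^{-2|z|^2}$; complex conjugation is
an isometry of $\mathcal L^{p'(\cdot)}$ and turns it into the sesquilinear one.

Upper bound. Splitting the weight as $e^{-|z|^2}\cdot e^{-|z|^2}$, the pointwise Young inequality
`power_young` bounds the integral of $|fh|e^{-2|z|^2}$ by $C_p+C_{p'}$ when both modulars are at
most $1$, and scaling gives Hölder's inequality.

Lower bound. Suppose $g\in L^1$ pairs with bounded functions with norm at most $M$ relative to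
$\mathcal L^{p(\cdot)}$. Put $G=|g|e^{|z|^2}/(MK)$ with $K>1/C_p$, and test with $f$ having the
phase of $\bar g$ and $|f|e^{-|z|^2}\le H$, where $H$ is a truncation of $G^{p'-1}$. Then $H^p\le
GH$, so $J=\int GH$ bounds the modular of $f$ and is also, up to the factor $MK$, the value of the
pairing. The resulting inequality $KJ\le\max(1,J/C_p)$ forces $J\le 1/K$
(`lintegral_le_inv_of_test`). Removing the truncation by monotone convergence bounds the conjugate
modular of $g\,e^{2|z|^2}$ (`modular_conj_le_one`).

Surjectivity. Here $p^+<\infty$ enters, through dominated convergence in norm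
(`tendsto_norm_zero_of_dominated`). It makes $E\mapsto\varphi(1_E)$ a complex measure, which has a
Radon–Nikodym density $g$, and it makes bounded functions dense. The lower estimate applied to $g$
places $h=\frac\pi2 g\,e^{2|z|^2}$ in $\mathcal L^{p'(\cdot)}$, and $h$ represents $\varphi$. -/

noncomputable section

open VariableExponent

/-! ### Conjugate exponents, Young's and Hölder's inequalities -/

lemma ENNReal.eq_one_or_toReal_holderConjugate {a b : ℝ≥0∞} (ha : a ≠ ∞) (h : a⁻¹ + b⁻¹ = 1) :
    (a = 1 ∧ b = ∞) ∨ (a ≠ 1 ∧ b ≠ ∞ ∧ a.toReal.HolderConjugate b.toReal) := by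
  by_cases hb : b = ∞
  · left
    subst hb
    simpa using h
  · right
    have ha0 : a⁻¹ ≠ ∞ := fun h' => by simp [h'] at h
    have hb0 : b⁻¹ ≠ ∞ := fun h' => by simp [h'] at h
    have ha1 : a ≠ 1 := by
      rintro rfl
      have : b⁻¹ = 0 := by
        have h2 : (1 : ℝ≥0∞) + b⁻¹ = 1 + 0 := by simpa using h
        exact (ENNReal.add_right_inj one_ne_top).1 h2
      exact hb (by simpa using this)
    refine ⟨ha1, hb, Real.holderConjugate_iff.2 ⟨?_, ?_⟩⟩
    · have h1 : 1 ≤ a := by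
        rw [← ENNReal.inv_le_one]
        exact h ▸ le_self_add
      have h2 : 1 < a := lt_of_le_of_ne h1 (Ne.symm ha1)
      simpa using (ENNReal.toReal_lt_toReal one_ne_top ha).2 h2
    · rw [← ENNReal.toReal_inv, ← ENNReal.toReal_inv, ← ENNReal.toReal_add ha0 hb0, h,
        ENNReal.toReal_one]

namespace VariableExponent

/-- At the endpoint $a=1$, $b=\infty$ the second term is infinite if $t>1$, and $st\le s$ otherwise.
For finite exponents this is Young's inequality without its weights $1/a,1/b\le1$. -/
lemma power_young {a b : ℝ≥0∞} (ha : a ≠ ∞) (h : a⁻¹ + b⁻¹ = 1) (s t : ℝ≥0∞) :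
    s * t ≤ power a s + power b t := by
  rcases ENNReal.eq_one_or_toReal_holderConjugate ha h with ⟨rfl, rfl⟩ | ⟨-, hb, hab⟩
  · by_cases ht : t ≤ 1
    · simpa [power, ht] using mul_le_of_le_one_right' ht
    · simp [power, ht]
  · simp only [power, ha, hb, if_false]
    refine (ENNReal.young_inequality s t hab).trans ?_
    gcongr
    · exact ENNReal.div_le_of_le_mul (le_mul_of_one_le_right' (by simpa using hab.lt.le))
    · exact ENNReal.div_le_of_le_mul (le_mul_of_one_le_right' (by simpa using hab.symm.lt.le))

lemma rawModular_le_of_modular_le_one (q : VariableExponent) {f : ℂ → ℂ} (h : modular q f ≤ 1) :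
    rawModular q f ≤ gaussConst q := by
  unfold modular at h
  -- If $C_q=0$, the factor $C_q^{-1}=\infty$ lets the modular be at most $1$ only when the integral
  -- vanishes.
  by_cases h0 : gaussConst q = 0
  · by_contra hr
    have : rawModular q f ≠ 0 := fun h' => hr (by simp [h'])
    simp [h0, this, ENNReal.top_mul] at h
  · simpa using (ENNReal.inv_mul_le_iff h0 (gaussConst_ne_top q)).1 h

lemma enorm_mul_mul_exp (a b : ℂ) (z : ℂ) :
    ‖a * b * (Real.exp (-2 * ‖z‖ ^ 2) : ℂ)‖ₑ =
      (‖a‖ₑ * ENNReal.ofReal (Real.exp (-‖z‖ ^ 2))) *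
        (‖b‖ₑ * ENNReal.ofReal (Real.exp (-‖z‖ ^ 2))) := by
  have h : Real.exp (-2 * ‖z‖ ^ 2) = Real.exp (-‖z‖ ^ 2) * Real.exp (-‖z‖ ^ 2) := by
    rw [← Real.exp_add]; ring_nf
  rw [h, enorm_mul, enorm_mul, ← ofReal_norm ((_ : ℝ) : ℂ), Complex.norm_real,
    Real.norm_of_nonneg (by positivity), ENNReal.ofReal_mul (by positivity)]
  ring

/-- Hölder's inequality in modular form. -/
lemma lintegral_enorm_mul_le {p p' : VariableExponent} (hp : ∀ z, p z < ∞)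
    (hpp' : ∀ z, (p z)⁻¹ + (p' z)⁻¹ = 1) {f h : ℂ → ℂ} (hf : AEStronglyMeasurable f volume)
    (hf1 : modular p f ≤ 1) (hh1 : modular p' h ≤ 1) :
    ∫⁻ z, ‖f z * h z * (Real.exp (-2 * ‖z‖ ^ 2) : ℂ)‖ₑ ≤ gaussConst p + gaussConst p' := by
  calc ∫⁻ z, ‖f z * h z * (Real.exp (-2 * ‖z‖ ^ 2) : ℂ)‖ₑ
      ≤ ∫⁻ z, (power (p z) (‖f z‖ₑ * ENNReal.ofReal (Real.exp (-‖z‖ ^ 2))) +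
          power (p' z) (‖h z‖ₑ * ENNReal.ofReal (Real.exp (-‖z‖ ^ 2)))) := by
        refine lintegral_mono fun z => ?_
        rw [enorm_mul_mul_exp]
        exact power_young (hp z).ne (hpp' z) _ _
    _ = rawModular p f + rawModular p' h := lintegral_add_left' (aemeasurable_integrand p hf) _
    _ ≤ _ := add_le_add (rawModular_le_of_modular_le_one p hf1)
        (rawModular_le_of_modular_le_one p' hh1)

/-- A finite exponent makes the integrand positive everywhere. Finiteness matters: the constant of
an exponent equal to $\infty$ almost everywhere is $0$. -/
lemma gaussConst_ne_zero {p : VariableExponent} (hp : ∀ z, p z < ∞) : gaussConst p ≠ 0 := by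
  unfold gaussConst
  have hm := aemeasurable_integrand p (f := fun _ => 1) aestronglyMeasurable_const
  simp only [enorm_one, one_mul] at hm
  rw [Ne, lintegral_eq_zero_iff' hm]
  intro h
  have : ∀ᵐ z : ℂ, False := by
    filter_upwards [h] with z hz
    simp [power, (hp z).ne] at hz
    exact absurd hz.1 (not_le.2 (Real.exp_pos _))
  obtain ⟨_, h⟩ := this.exists
  exact h

/-- The normalization by $C_p$ is made for this: bounded functions lie in the space for every
exponent, with norm at most their bound. The inequality also covers $C_p=0$, where the modular is
$0$. -/
lemma modular_const_one_le (p : VariableExponent) : modular p (fun _ => 1) ≤ 1 := by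
  simp only [modular, rawModular, enorm_one, one_mul]
  exact ENNReal.inv_mul_le_one _

end VariableExponent

namespace GaussianLp

variable {p p' q : VariableExponent}

/-- The Hölder bound for the Gaussian pairing. -/
lemma lintegral_pairing_le (hp : ∀ z, p z < ∞) (hpp' : ∀ z, (p z)⁻¹ + (p' z)⁻¹ = 1)
    {f h : ℂ → ℂ} (hf : AEStronglyMeasurable f volume) {s t : ℝ} (hs : 0 < s) (ht : 0 < t)
    (hf1 : modular p (fun z => f z / (s : ℂ)) ≤ 1)
    (hh1 : modular p' (fun z => h z / (t : ℂ)) ≤ 1) :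
    ∫⁻ z, ‖f z * h z * (Real.exp (-2 * ‖z‖ ^ 2) : ℂ)‖ₑ ≤
      ENNReal.ofReal (s * t) * (gaussConst p + gaussConst p') := by
  have hm : AEStronglyMeasurable (fun z => f z / (s : ℂ)) volume := by
    simpa only [div_eq_mul_inv] using hf.mul_const _
  refine le_trans (le_of_eq ?_) (mul_le_mul_right (lintegral_enorm_mul_le hp hpp' hm hf1 hh1) _)
  rw [← lintegral_const_mul' _ _ ENNReal.ofReal_ne_top]
  refine lintegral_congr fun z => ?_
  have hsC : (s : ℂ) ≠ 0 := by exact_mod_cast hs.ne'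
  have htC : (t : ℂ) ≠ 0 := by exact_mod_cast ht.ne'
  have : f z * h z * (Real.exp (-2 * ‖z‖ ^ 2) : ℂ) =
      ((s * t : ℝ) : ℂ) * (f z / s * (h z / t) * (Real.exp (-2 * ‖z‖ ^ 2) : ℂ)) := by
    push_cast; field_simp
  rw [this, enorm_mul, ← ofReal_norm ((_ : ℝ) : ℂ), Complex.norm_real,
    Real.norm_of_nonneg (by positivity)]

lemma integrable_pairing (hp : ∀ z, p z < ∞) (hpp' : ∀ z, (p z)⁻¹ + (p' z)⁻¹ = 1)
    (f : GaussianLp p) (h : GaussianLp p') :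
    Integrable (fun z => (f : ℂ →ₘ[volume] ℂ) z * (h : ℂ →ₘ[volume] ℂ) z *
      (Real.exp (-2 * ‖z‖ ^ 2) : ℂ)) := by
  have hf0 : 0 ≤ ‖f‖ := luxNorm_nonneg _
  have hh0 : 0 ≤ ‖h‖ := luxNorm_nonneg _
  refine ⟨((f : ℂ →ₘ[volume] ℂ).aestronglyMeasurable.mul
    (h : ℂ →ₘ[volume] ℂ).aestronglyMeasurable).mul (by fun_prop), ?_⟩
  refine (lintegral_pairing_le hp hpp' (f : ℂ →ₘ[volume] ℂ).aestronglyMeasurable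
    (s := ‖f‖ + 1) (t := ‖h‖ + 1) (by positivity) (by positivity)
    (modular_le_one_of_lt f (by linarith)) (modular_le_one_of_lt h (by linarith))).trans_lt ?_
  exact ENNReal.mul_lt_top ENNReal.ofReal_lt_top
    (ENNReal.add_lt_top.2 ⟨(gaussConst_ne_top p).lt_top, (gaussConst_ne_top p').lt_top⟩)

lemma norm_integral_pairing_le (hp : ∀ z, p z < ∞) (hpp' : ∀ z, (p z)⁻¹ + (p' z)⁻¹ = 1)
    (f : GaussianLp p) (h : GaussianLp p') :
    ‖∫ z, (f : ℂ →ₘ[volume] ℂ) z * (h : ℂ →ₘ[volume] ℂ) z * (Real.exp (-2 * ‖z‖ ^ 2) : ℂ)‖ ≤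
      ((gaussConst p).toReal + (gaussConst p').toReal) * ‖h‖ * ‖f‖ := by
  have hf0 : 0 ≤ ‖f‖ := luxNorm_nonneg _
  have hh0 : 0 ≤ ‖h‖ := luxNorm_nonneg _
  set A := ‖∫ z, (f : ℂ →ₘ[volume] ℂ) z * (h : ℂ →ₘ[volume] ℂ) z *
    (Real.exp (-2 * ‖z‖ ^ 2) : ℂ)‖ with hA
  set D := (gaussConst p).toReal + (gaussConst p').toReal with hD
  -- A scale strictly above the norm is admissible in the Luxemburg infimum, and is positive even
  -- for the zero class; $\varepsilon\to0$ at the end.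
  have key : ∀ ε : ℝ, 0 < ε → A ≤ (‖f‖ + ε) * (‖h‖ + ε) * D := fun ε hε => by
    have h1 := lintegral_pairing_le hp hpp' (f : ℂ →ₘ[volume] ℂ).aestronglyMeasurable
      (s := ‖f‖ + ε) (t := ‖h‖ + ε) (by positivity) (by positivity)
      (modular_le_one_of_lt f (by linarith)) (modular_le_one_of_lt h (by linarith))
    have h2 := (enorm_integral_le_lintegral_enorm _).trans h1
    rw [← ofReal_norm, ← hA, ← ENNReal.ofReal_toReal (gaussConst_ne_top p),
      ← ENNReal.ofReal_toReal (gaussConst_ne_top p'), ← ENNReal.ofReal_add (by positivity)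
      (by positivity), ← ENNReal.ofReal_mul (by positivity)] at h2
    exact (ENNReal.ofReal_le_ofReal_iff (by positivity)).1 h2
  have hcont : Filter.Tendsto (fun ε : ℝ => (‖f‖ + ε) * (‖h‖ + ε) * D)
      (nhdsWithin 0 (Set.Ioi 0)) (nhds (D * ‖h‖ * ‖f‖)) := by
    have : Continuous fun ε : ℝ => (‖f‖ + ε) * (‖h‖ + ε) * D := by fun_prop
    have h0 := (this.tendsto 0).mono_left (nhdsWithin_le_nhds (s := Set.Ioi 0))
    convert h0 using 2
    ring
  exact ge_of_tendsto hcont (Filter.eventually_of_mem self_mem_nhdsWithin key)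

/-! ### Classes of functions with controlled modular -/

/-- The class of a measurable function whose modular is finite after scaling. -/
def mk (f : ℂ → ℂ) (hf : AEStronglyMeasurable f volume) {t : ℝ} (ht : 0 < t)
    (h : modular q (fun z => f z / (t : ℂ)) ≤ 1) : GaussianLp q :=
  ⟨AEEqFun.mk f hf, t⁻¹, inv_pos.2 ht, by
    refine lt_of_le_of_lt (le_of_eq ?_) (h.trans_lt one_lt_top)
    refine modular_congr q ?_
    filter_upwards [AEEqFun.coeFn_mk f hf] with z hz
    rw [hz]
    push_cast
    field_simp⟩

lemma coeFn_mk (f : ℂ → ℂ) (hf : AEStronglyMeasurable f volume) {t : ℝ} (ht : 0 < t)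
    (h : modular q (fun z => f z / (t : ℂ)) ≤ 1) :
    (mk f hf ht h : ℂ →ₘ[volume] ℂ) =ᵐ[volume] f := AEEqFun.coeFn_mk f hf

lemma norm_le_of_ae (f : GaussianLp q) {g : ℂ → ℂ} (hg : (f : ℂ →ₘ[volume] ℂ) =ᵐ[volume] g)
    {t : ℝ} (ht : 0 < t) (h : modular q (fun z => g z / (t : ℂ)) ≤ 1) : ‖f‖ ≤ t := by
  refine norm_le_of_modular f ht (le_trans (le_of_eq (modular_congr q ?_)) h)
  filter_upwards [hg] with z hz
  rw [hz]

lemma norm_mk_le (f : ℂ → ℂ) (hf : AEStronglyMeasurable f volume) {t : ℝ} (ht : 0 < t)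
    (h : modular q (fun z => f z / (t : ℂ)) ≤ 1) : ‖mk f hf ht h‖ ≤ t :=
  norm_le_of_ae _ (coeFn_mk f hf ht h) ht h

lemma ext_ae {f g : GaussianLp q}
    (h : (f : ℂ →ₘ[volume] ℂ) =ᵐ[volume] (g : ℂ →ₘ[volume] ℂ)) : f = g :=
  Subtype.ext (AEEqFun.ext h)

end GaussianLp

/-! ### Dominated convergence in norm for bounded exponents -/

namespace VariableExponent

/-- With exponents bounded by a finite $P$, rescaling the argument costs a factor independent of the
point. The maximum with $1$ makes the power of the scale increasing in the exponent. -/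
lemma power_ofReal_mul_le {a P : ℝ≥0∞} (ha : a ≤ P) (hP : P ≠ ∞) (s t : ℝ≥0∞) :
    power a (s * t) ≤ (max 1 s) ^ P.toReal * power a t := by
  have ha' : a ≠ ∞ := ne_top_of_le_ne_top hP ha
  simp only [power, ha', if_false]
  rw [ENNReal.mul_rpow_of_nonneg _ _ ENNReal.toReal_nonneg]
  gcongr
  calc s ^ a.toReal ≤ (max 1 s) ^ a.toReal :=
        ENNReal.rpow_le_rpow (le_max_right _ _) ENNReal.toReal_nonneg
    _ ≤ _ := ENNReal.rpow_le_rpow_of_exponent_le (le_max_left _ _) (ENNReal.toReal_mono hP ha)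

lemma measurable_integrand (q : VariableExponent) {f : ℂ → ℂ} (hf : Measurable f) :
    Measurable (fun z => power (q z) (‖f z‖ₑ * ENNReal.ofReal (Real.exp (-‖z‖ ^ 2)))) := by
  have hq := q.measurable_toFun
  unfold power
  refine Measurable.ite (hq (measurableSet_singleton _)) ?_ ?_
  · exact Measurable.ite (measurableSet_le (by fun_prop) measurable_const)
      measurable_const measurable_const
  · exact Measurable.pow (by fun_prop) (by fun_prop)

end VariableExponent

namespace GaussianLp

variable {p q : VariableExponent}

open Filter Topology

/-- Dominated convergence in norm for a bounded exponent. -/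
lemma tendsto_norm_zero_of_dominated {ι : Type*} {l : Filter ι} [l.IsCountablyGenerated]
    (hp : p.IsBounded) (u : ι → GaussianLp p) (F : GaussianLp p)
    (hb : ∀ᶠ i in l, ∀ᵐ z, ‖(u i : ℂ →ₘ[volume] ℂ) z‖ ≤ ‖(F : ℂ →ₘ[volume] ℂ) z‖)
    (hlim : ∀ᵐ z, Tendsto (fun i => (u i : ℂ →ₘ[volume] ℂ) z) l (𝓝 0)) :
    Tendsto (fun i => ‖u i‖) l (𝓝 0) := by
  have hF0 : 0 ≤ ‖F‖ := luxNorm_nonneg _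
  set t := ‖F‖ + 1 with ht
  have ht0 : 0 < t := by positivity
  have hFt := rawModular_le_of_modular_le_one p (modular_le_one_of_lt F (t := t) (by linarith))
  have key : ∀ ε : ℝ, 0 < ε → ∀ᶠ i in l, ‖u i‖ ≤ ε := by
    intro ε hε
    have hεC : (ε : ℂ) ≠ 0 := by exact_mod_cast hε.ne'
    have htC : (t : ℂ) ≠ 0 := by exact_mod_cast ht0.ne'
    -- For fixed $\varepsilon$, $\|u_i\|\le\varepsilon$ follows once the unnormalized modular of
    -- $u_i/\varepsilon$ is below $C_p>0$, so its convergence to $0$ suffices.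
    have h0 : Tendsto (fun i => rawModular p
        (fun z => (u i : ℂ →ₘ[volume] ℂ) z / (ε : ℂ))) l (𝓝 (∫⁻ _ : ℂ, 0)) := by
      -- The majorant comes from $|u_i/\varepsilon|\le|t/\varepsilon|\,|F/t|$: the modular of $F/t$
      -- is finite, and the scale $t/\varepsilon$ is absorbed using $p\le p^+$.
      refine tendsto_lintegral_filter_of_dominated_convergence
        (fun z => (max 1 ‖(t : ℂ) / ε‖ₑ) ^ (essSup p volume).toReal *
          power (p z) (‖(F : ℂ →ₘ[volume] ℂ) z / (t : ℂ)‖ₑ *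
            ENNReal.ofReal (Real.exp (-‖z‖ ^ 2)))) ?_ ?_ ?_ ?_
      · exact Eventually.of_forall fun i => measurable_integrand p
          ((u i : ℂ →ₘ[volume] ℂ).stronglyMeasurable.measurable.div_const _)
      · filter_upwards [hb] with i hi
        filter_upwards [hi, ENNReal.ae_le_essSup (μ := volume) p] with z hz hpz
        refine le_trans (power_mono ?_) (power_ofReal_mul_le hpz hp.2.ne _ _)
        rw [← mul_assoc, ← enorm_mul]
        gcongr
        rw [enorm_le_iff_norm_le, div_mul_div_comm, mul_comm (t : ℂ), mul_div_mul_right _ _ htC,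
          norm_div, norm_div]
        gcongr
      · rw [lintegral_const_mul' _ _ (ENNReal.rpow_ne_top_of_nonneg ENNReal.toReal_nonneg
          (by simp))]
        refine ENNReal.mul_ne_top (ENNReal.rpow_ne_top_of_nonneg ENNReal.toReal_nonneg
          (by simp)) ?_
        exact ne_top_of_le_ne_top (gaussConst_ne_top p) hFt
      · filter_upwards [hlim] with z hz
        have hpos : 0 < (p z).toReal :=
          ENNReal.toReal_pos (zero_lt_one.trans_le (p.one_le z)).ne' (hp.1 z).ne
        have h1 : Tendsto (fun i => ‖(u i : ℂ →ₘ[volume] ℂ) z / (ε : ℂ)‖ₑ *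
            ENNReal.ofReal (Real.exp (-‖z‖ ^ 2))) l (𝓝 0) := by
          have h2 : Tendsto (fun i => ‖(u i : ℂ →ₘ[volume] ℂ) z / (ε : ℂ)‖ₑ) l (𝓝 0) := by
            simpa using (hz.div_const (ε : ℂ)).enorm
          simpa using ENNReal.Tendsto.mul_const h2 (Or.inr ENNReal.ofReal_ne_top)
        simp only [power, (hp.1 z).ne, if_false]
        have h3 := ((ENNReal.continuous_rpow_const (y := (p z).toReal)).tendsto 0).comp h1
        simp only [ENNReal.zero_rpow_of_pos hpos] at h3
        exact h3
    rw [lintegral_zero] at h0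
    have hC : 0 < gaussConst p := pos_iff_ne_zero.2 (gaussConst_ne_zero hp.1)
    filter_upwards [h0.eventually (gt_mem_nhds hC)] with i hi
    refine norm_le_of_modular _ hε ?_
    exact (mul_le_mul_right hi.le _).trans (ENNReal.inv_mul_le_one _)
  rw [Metric.tendsto_nhds]
  intro ε hε
  filter_upwards [key (ε / 2) (by positivity)] with i hi
  have hi0 : 0 ≤ ‖u i‖ := luxNorm_nonneg _
  rw [Real.dist_eq, sub_zero, abs_of_nonneg hi0]
  linarith

/-! ### Bounded functions and the Radon–Nikodym density of a functional -/

lemma modular_div_le_one_of_norm_le {f : ℂ → ℂ} {c : ℝ} (hc : 0 < c) (hf : ∀ z, ‖f z‖ ≤ c) :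
    modular q (fun z => f z / (c : ℂ)) ≤ 1 := by
  refine (modular_mono q fun z => ?_).trans (modular_const_one_le q)
  rw [norm_div, Complex.norm_real, Real.norm_of_nonneg hc.le, norm_one, div_le_one hc]
  exact hf z

/-- The class of a bounded measurable function. -/
def ofBounded (f : ℂ → ℂ) (hf : AEStronglyMeasurable f volume) {c : ℝ} (hc : 0 < c)
    (hfc : ∀ z, ‖f z‖ ≤ c) : GaussianLp q :=
  mk f hf hc (modular_div_le_one_of_norm_le hc hfc)

lemma coeFn_ofBounded (f : ℂ → ℂ) (hf : AEStronglyMeasurable f volume) {c : ℝ} (hc : 0 < c)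
    (hfc : ∀ z, ‖f z‖ ≤ c) :
    (ofBounded f hf hc hfc : GaussianLp q).1 =ᵐ[volume] f :=
  coeFn_mk _ _ _ _

open Classical in
/-- The class of the indicator function of a measurable set (and `0` for other sets). -/
def indicatorOne (q : VariableExponent) (E : Set ℂ) : GaussianLp q :=
  if hE : MeasurableSet E then
    ofBounded (E.indicator 1) (aestronglyMeasurable_const.indicator hE) one_pos fun z => by
      by_cases hz : z ∈ E <;> simp [hz]
  else 0

lemma coeFn_indicatorOne {E : Set ℂ} (hE : MeasurableSet E) :
    ((indicatorOne q E : GaussianLp q) : ℂ →ₘ[volume] ℂ) =ᵐ[volume] E.indicator 1 := by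
  rw [indicatorOne, dif_pos hE]
  exact coeFn_ofBounded _ _ _ _

lemma coeFn_add' (f g : GaussianLp q) :
    ((f + g : GaussianLp q) : ℂ →ₘ[volume] ℂ) =ᵐ[volume]
      fun z => (f : ℂ →ₘ[volume] ℂ) z + (g : ℂ →ₘ[volume] ℂ) z :=
  AEEqFun.coeFn_add _ _

lemma coeFn_sub' (f g : GaussianLp q) :
    ((f - g : GaussianLp q) : ℂ →ₘ[volume] ℂ) =ᵐ[volume]
      fun z => (f : ℂ →ₘ[volume] ℂ) z - (g : ℂ →ₘ[volume] ℂ) z :=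
  AEEqFun.coeFn_sub _ _

lemma coeFn_smul' (c : ℂ) (f : GaussianLp q) :
    ((c • f : GaussianLp q) : ℂ →ₘ[volume] ℂ) =ᵐ[volume]
      fun z => c * (f : ℂ →ₘ[volume] ℂ) z :=
  AEEqFun.coeFn_smul _ _

lemma coeFn_zero' : ((0 : GaussianLp q) : ℂ →ₘ[volume] ℂ) =ᵐ[volume] fun _ => (0 : ℂ) :=
  AEEqFun.coeFn_zero

lemma coeFn_sum_indicatorOne {A : ℕ → Set ℂ} (hA : ∀ i, MeasurableSet (A i))
    (hd : Pairwise (Function.onFun Disjoint A)) (s : Finset ℕ) :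
    ((∑ i ∈ s, indicatorOne q (A i) : GaussianLp q) : ℂ →ₘ[volume] ℂ) =ᵐ[volume]
      (⋃ i ∈ s, A i).indicator 1 := by
  rw [Finset.indicator_biUnion s A (fun i _ j _ hij => hd hij)]
  induction s using Finset.induction_on with
  | empty => simpa using coeFn_zero' (q := q)
  | insert a s ha ih =>
    rw [Finset.sum_insert ha]
    filter_upwards [coeFn_add' (indicatorOne q (A a)) (∑ i ∈ s, indicatorOne q (A i)), ih,
      coeFn_indicatorOne (q := q) (hA a)] with z h1 h2 h3
    rw [h1, h2, h3, Finset.sum_insert ha]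

/-- Partial sums are indicators of finite unions. Their differences from the full indicator are
dominated by the constant $1$ and vanish at each point eventually along finite index sets, so
dominated convergence in norm applies. -/
lemma hasSum_indicatorOne (hp : p.IsBounded) {A : ℕ → Set ℂ} (hA : ∀ i, MeasurableSet (A i))
    (hd : Pairwise (Function.onFun Disjoint A)) :
    HasSum (fun i => indicatorOne p (A i)) (indicatorOne p (⋃ i, A i)) := by
  rw [HasSum, SummationFilter.unconditional_filter, tendsto_iff_norm_sub_tendsto_zero]
  have hae : ∀ᵐ z, ∀ s : Finset ℕ,
      ((∑ i ∈ s, indicatorOne p (A i) - indicatorOne p (⋃ i, A i) : GaussianLp p) :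
        ℂ →ₘ[volume] ℂ) z = (⋃ i ∈ s, A i).indicator 1 z - (⋃ i, A i).indicator 1 z := by
    rw [ae_all_iff]
    intro s
    filter_upwards [coeFn_sub' (∑ i ∈ s, indicatorOne p (A i)) (indicatorOne p (⋃ i, A i)),
      coeFn_sum_indicatorOne (q := p) hA hd s,
      coeFn_indicatorOne (q := p) (MeasurableSet.iUnion hA)] with z h1 h2 h3
    rw [h1, h2, h3]
  refine tendsto_norm_zero_of_dominated hp _ (indicatorOne p Set.univ) ?_ ?_
  · refine Eventually.of_forall fun s => ?_
    filter_upwards [hae, coeFn_indicatorOne (q := p) MeasurableSet.univ] with z h1 h2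
    rw [h1 s, h2]
    by_cases hz : z ∈ ⋃ i ∈ s, A i
    · have hz' : z ∈ ⋃ i, A i := Set.iUnion₂_subset_iUnion _ _ hz
      rw [Set.indicator_of_mem hz, Set.indicator_of_mem hz']
      simp
    · rw [Set.indicator_of_notMem hz]
      by_cases hz' : z ∈ ⋃ i, A i
      · rw [Set.indicator_of_mem hz']; simp
      · rw [Set.indicator_of_notMem hz']; simp
  · filter_upwards [hae] with z h1
    simp only [h1]
    by_cases hz' : z ∈ ⋃ i, A i
    · obtain ⟨j, hj⟩ := Set.mem_iUnion.1 hz'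
      refine tendsto_const_nhds.congr' ?_
      filter_upwards [eventually_ge_atTop {j}] with s hs
      have hz : z ∈ ⋃ i ∈ s, A i :=
        Set.mem_iUnion₂.2 ⟨j, hs (Finset.mem_singleton_self j), hj⟩
      rw [Set.indicator_of_mem hz, Set.indicator_of_mem hz']
      simp
    · refine tendsto_const_nhds.congr fun s => ?_
      have hz : z ∉ ⋃ i ∈ s, A i := fun h => hz' (Set.iUnion₂_subset_iUnion _ _ h)
      rw [Set.indicator_of_notMem hz, Set.indicator_of_notMem hz', sub_zero]

/-- The complex measure `E ↦ φ(1_E)` of a bounded functional. -/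
def functionalMeasure (hp : p.IsBounded) (φ : StrongDual ℂ (GaussianLp p)) :
    ComplexMeasure ℂ where
  measureOf' E := φ (indicatorOne p E)
  empty' := by
    have : indicatorOne p ∅ = 0 := ext_ae <| by
      filter_upwards [coeFn_indicatorOne (q := p) MeasurableSet.empty, coeFn_zero' (q := p)]
        with z h1 h2
      rw [h1, h2]; simp
    rw [this, map_zero]
  not_measurable' E hE := by rw [indicatorOne, dif_neg hE, map_zero]
  m_iUnion' _ hA hd := φ.hasSum (hasSum_indicatorOne hp hA hd)

lemma functionalMeasure_apply (hp : p.IsBounded) (φ : StrongDual ℂ (GaussianLp p)) (E : Set ℂ) :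
    functionalMeasure hp φ E = φ (indicatorOne p E) := rfl

lemma functionalMeasure_eq_zero (hp : p.IsBounded) (φ : StrongDual ℂ (GaussianLp p)) {E : Set ℂ}
    (hE : volume E = 0) : functionalMeasure hp φ E = 0 := by
  by_cases hm : MeasurableSet E
  · have : indicatorOne p E = 0 := ext_ae <| by
      filter_upwards [coeFn_indicatorOne (q := p) hm, coeFn_zero' (q := p),
        measure_eq_zero_iff_ae_notMem.1 hE] with z h1 h2 h3
      rw [h1, h2, Set.indicator_of_notMem h3]
    rw [functionalMeasure_apply, this, map_zero]
  · exact VectorMeasure.not_measurable _ hm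

/-- The complex measure of $\varphi$ vanishes on null sets, so Radon–Nikodym applies to its real and
imaginary parts separately. -/
lemma exists_density_indicator (hp : p.IsBounded) (φ : StrongDual ℂ (GaussianLp p)) :
    ∃ g : ℂ → ℂ, Integrable g ∧ ∀ E, MeasurableSet E → φ (indicatorOne p E) = ∫ z in E, g z := by
  set ν := functionalMeasure hp φ
  have hac : ∀ s : Set ℂ, (volume : Measure ℂ).toENNRealVectorMeasure s = 0 → ν s = 0 := by
    intro s hs
    by_cases hm : MeasurableSet s
    · rw [Measure.toENNRealVectorMeasure_apply_measurable hm] at hs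
      exact functionalMeasure_eq_zero hp φ hs
    · exact VectorMeasure.not_measurable _ hm
  have hre : (volume : Measure ℂ).withDensityᵥ (ν.re.rnDeriv volume) = ν.re :=
    SignedMeasure.withDensityᵥ_rnDeriv_eq _ _ fun s hs => by
      change (ν s).re = 0
      rw [hac s hs, Complex.zero_re]
  have him : (volume : Measure ℂ).withDensityᵥ (ν.im.rnDeriv volume) = ν.im :=
    SignedMeasure.withDensityᵥ_rnDeriv_eq _ _ fun s hs => by
      change (ν s).im = 0
      rw [hac s hs, Complex.zero_im]
  have h1 := SignedMeasure.integrable_rnDeriv ν.re volume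
  have h2 := SignedMeasure.integrable_rnDeriv ν.im volume
  refine ⟨fun z => ((ν.re.rnDeriv volume z : ℝ) : ℂ) +
    ((ν.im.rnDeriv volume z : ℝ) : ℂ) * Complex.I, h1.ofReal.add (h2.ofReal.mul_const _), ?_⟩
  intro E hE
  have h1' : Integrable (fun z => ((ν.re.rnDeriv volume z : ℝ) : ℂ)) (volume.restrict E) :=
    h1.ofReal.integrableOn
  have h2' : Integrable (fun z => ((ν.im.rnDeriv volume z : ℝ) : ℂ) * Complex.I)
      (volume.restrict E) := (h2.ofReal.mul_const _).integrableOn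
  rw [integral_add h1' h2',
    integral_mul_const, integral_complex_ofReal, integral_complex_ofReal,
    ← withDensityᵥ_apply h1 hE, ← withDensityᵥ_apply h2 hE, hre, him,
    ← functionalMeasure_apply hp φ E]
  exact (Complex.re_add_im _).symm

lemma exists_density_simpleFunc (hp : p.IsBounded) (φ : StrongDual ℂ (GaussianLp p)) :
    ∃ g : ℂ → ℂ, Integrable g ∧ ∀ (s : SimpleFunc ℂ ℂ) (f : GaussianLp p),
      (f : ℂ →ₘ[volume] ℂ) =ᵐ[volume] s → φ f = ∫ z, s z * g z := by
  obtain ⟨g, hg, hgE⟩ := exists_density_indicator hp φ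
  refine ⟨g, hg, fun s => ?_⟩
  induction s using SimpleFunc.induction with
  | const c hs =>
    rename_i E
    intro f hf
    have : f = c • indicatorOne p E := ext_ae <| by
      filter_upwards [hf, coeFn_smul' c (indicatorOne p E), coeFn_indicatorOne (q := p) hs]
        with z h1 h2 h3
      rw [h1, h2, h3]
      by_cases hz : z ∈ E <;> simp [hz]
    rw [this, map_smul, hgE E hs, smul_eq_mul, ← integral_const_mul, ← integral_indicator hs]
    refine integral_congr_ae (Eventually.of_forall fun z => ?_)
    by_cases hz : z ∈ E <;> simp [hz]
  | add _ ihs iht =>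
    rename_i s t _
    intro f hf
    obtain ⟨c, hc⟩ := s.exists_forall_norm_le
    obtain ⟨d, hd⟩ := t.exists_forall_norm_le
    have hs := s.measurable.aestronglyMeasurable (μ := volume)
    have ht := t.measurable.aestronglyMeasurable (μ := volume)
    let u : GaussianLp p := ofBounded s hs (c := max 1 c) (by positivity)
      fun z => (hc z).trans (le_max_right _ _)
    let v : GaussianLp p := ofBounded t ht (c := max 1 d) (by positivity)
      fun z => (hd z).trans (le_max_right _ _)
    have hu : (u : ℂ →ₘ[volume] ℂ) =ᵐ[volume] s := coeFn_ofBounded _ _ _ _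
    have hv : (v : ℂ →ₘ[volume] ℂ) =ᵐ[volume] t := coeFn_ofBounded _ _ _ _
    have : f = u + v := ext_ae <| by
      filter_upwards [hf, coeFn_add' u v, hu, hv] with z h1 h2 h3 h4
      rw [h1, h2, h3, h4, SimpleFunc.coe_add, Pi.add_apply]
    rw [this, map_add, ihs u hu, iht v hv,
      ← integral_add (hg.bdd_mul hs (Eventually.of_forall hc))
        (hg.bdd_mul ht (Eventually.of_forall hd))]
    refine integral_congr_ae (Eventually.of_forall fun z => ?_)
    simp [add_mul]

/-- A bounded functional is given on bounded functions by an integrable density. -/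
lemma exists_density_bounded (hp : p.IsBounded) (φ : StrongDual ℂ (GaussianLp p)) :
    ∃ g : ℂ → ℂ, Integrable g ∧ ∀ (f : GaussianLp p) (c : ℝ),
      (∀ᵐ z, ‖(f : ℂ →ₘ[volume] ℂ) z‖ ≤ c) →
        φ f = ∫ z, (f : ℂ →ₘ[volume] ℂ) z * g z := by
  obtain ⟨g, hg, hgs⟩ := exists_density_simpleFunc hp φ
  refine ⟨g, hg, fun f c hfc => ?_⟩
  have hc0 : 0 ≤ c := hfc.exists.elim fun _ h => (norm_nonneg _).trans h
  have hfm := (f : ℂ →ₘ[volume] ℂ).stronglyMeasurable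
  -- These simple functions stay bounded by $c$, which supplies a constant majorant in the norm
  -- limit and $c|g|$ in the integral limit.
  let s := hfm.approxBounded c
  have hsc : ∀ n z, ‖s n z‖ ≤ c := hfm.norm_approxBounded_le hc0
  have hlim : ∀ᵐ z, Tendsto (fun n => s n z) atTop (𝓝 ((f : ℂ →ₘ[volume] ℂ) z)) :=
    hfc.mono fun z hz => hfm.tendsto_approxBounded_of_norm_le hz
  have hsm : ∀ n, AEStronglyMeasurable (s n) volume := fun n =>
    (s n).measurable.aestronglyMeasurable
  -- The bound $c+1$ is used because $c$ may be $0$ and `ofBounded` requires a positive bound.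
  let u : ℕ → GaussianLp p := fun n => ofBounded (s n) (hsm n) (c := c + 1) (by positivity)
    fun z => (hsc n z).trans (by linarith)
  have hu : ∀ n, (u n : ℂ →ₘ[volume] ℂ) =ᵐ[volume] s n := fun n => coeFn_ofBounded _ _ _ _
  have hsub : ∀ᵐ z, ∀ n, ((u n - f : GaussianLp p) : ℂ →ₘ[volume] ℂ) z =
      s n z - (f : ℂ →ₘ[volume] ℂ) z := by
    rw [ae_all_iff]
    intro n
    filter_upwards [coeFn_sub' (u n) f, hu n] with z h1 h2
    rw [h1, h2]
  have hconv : Tendsto u atTop (𝓝 f) := by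
    rw [tendsto_iff_norm_sub_tendsto_zero]
    refine tendsto_norm_zero_of_dominated hp _ (((2 * c : ℝ) : ℂ) • indicatorOne p Set.univ)
      (Eventually.of_forall fun n => ?_) ?_
    · filter_upwards [hsub, coeFn_smul' ((2 * c : ℝ) : ℂ) (indicatorOne p Set.univ),
        coeFn_indicatorOne (q := p) MeasurableSet.univ, hfc] with z h1 h2 h3 h4
      rw [h1 n, h2, h3, norm_mul, Complex.norm_real, Real.norm_of_nonneg (by positivity)]
      simp only [Set.mem_univ, Set.indicator_of_mem, Pi.one_apply, norm_one, mul_one]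
      exact (norm_sub_le _ _).trans (by linarith [hsc n z])
    · filter_upwards [hsub, hlim] with z h1 h2
      simp only [h1]
      simpa using h2.sub_const ((f : ℂ →ₘ[volume] ℂ) z)
  have h1 : Tendsto (fun n => φ (u n)) atTop (𝓝 (φ f)) := (φ.continuous.tendsto f).comp hconv
  have h2 : Tendsto (fun n => φ (u n)) atTop (𝓝 (∫ z, (f : ℂ →ₘ[volume] ℂ) z * g z)) := by
    simp only [fun n => hgs (s n) (u n) (hu n)]
    refine tendsto_integral_of_dominated_convergence (fun z => c * ‖g z‖)
      (fun n => (hsm n).mul hg.1) (hg.norm.const_mul c) (fun n => ?_) ?_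
    · refine Eventually.of_forall fun z => ?_
      rw [norm_mul]
      gcongr
      exact hsc n z
    · exact hlim.mono fun z hz => hz.mul_const _
  exact tendsto_nhds_unique h1 h2

end GaussianLp

/-! ### The conjugate modular estimated by test functions -/

namespace VariableExponent

variable {p p' : VariableExponent} {g : ℂ → ℂ} {M K : ℝ}

/-- `g` pairs with bounded functions as a functional on `𝓛^{p(·)}` of norm at most `M`. -/
def PairingBound (p : VariableExponent) (g : ℂ → ℂ) (M : ℝ) : Prop :=
  ∀ f : ℂ → ℂ, Measurable f → (∃ c, ∀ z, ‖f z‖ ≤ c) → ∀ t : ℝ, 0 < t →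
    modular p (fun z => f z / (t : ℂ)) ≤ 1 → ‖∫ z, f z * g z‖ ≤ M * t

/-- The modulus `|g| e^{|z|²} / (M K)` to be estimated in `𝓛^{p'(·)}`. -/
def scaledModulus (g : ℂ → ℂ) (M K : ℝ) (z : ℂ) : ℝ :=
  ‖g z‖ * Real.exp (‖z‖ ^ 2) / (M * K)

lemma scaledModulus_nonneg (hM : 0 < M) (hK : 0 < K) (z : ℂ) : 0 ≤ scaledModulus g M K z := by
  unfold scaledModulus; positivity

/-- Let $J$ be the integral to be bounded and $D=C_p$. The hypothesis `hH` bounds the modular of the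
test function $f$ by $J/D$, while $\int fg=MKJ$. The pairing bound then reads $KJ\le\max(1,J/D)$. If
$J\ge D$ this contradicts $K>1/D$; otherwise $J\le1/K$. Boundedness of $He^{|z|^2}$ ensures that $J$
is finite. -/
lemma lintegral_le_inv_of_test (hp : ∀ z, p z < ∞) (hgm : Measurable g) (hg : Integrable g)
    (hM : 0 < M) (hK : (gaussConst p).toReal⁻¹ < K) (hb : PairingBound p g M)
    {H : ℂ → ℝ} (Hm : Measurable H) (H0 : ∀ z, 0 ≤ H z) {c : ℝ}
    (Hb : ∀ z, H z * Real.exp (‖z‖ ^ 2) ≤ c)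
    (hH : ∀ z, power (p z) (ENNReal.ofReal (H z)) ≤
      ENNReal.ofReal (scaledModulus g M K z * H z)) :
    ∫⁻ z, ENNReal.ofReal (scaledModulus g M K z * H z) ≤ ENNReal.ofReal K⁻¹ := by
  have hC : 0 < (gaussConst p).toReal :=
    ENNReal.toReal_pos (gaussConst_ne_zero hp) (gaussConst_ne_top p)
  set D := (gaussConst p).toReal with hD
  have hK0 : 0 < K := (inv_pos.2 hC).trans hK
  -- The phase makes $fg$ real and nonnegative, and $e^{|z|^2}$ cancels the weight in the modular.
  -- At zeros of $g$ the quotient is $0/0=0$, so only $|f|\le He^{|z|^2}$ holds there.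
  set f : ℂ → ℂ := fun z => (starRingEnd ℂ (g z) / (‖g z‖ : ℂ)) *
    ((H z * Real.exp (‖z‖ ^ 2) : ℝ) : ℂ) with hf
  have hfm : Measurable f := by fun_prop
  have hfn : ∀ z, ‖f z‖ ≤ H z * Real.exp (‖z‖ ^ 2) := fun z => by
    have hnn : 0 ≤ H z * Real.exp (‖z‖ ^ 2) := mul_nonneg (H0 z) (Real.exp_pos _).le
    simp only [hf, norm_mul, norm_div, RCLike.norm_conj, Complex.norm_real, norm_norm]
    rw [Real.norm_of_nonneg (H0 z), Real.norm_of_nonneg (Real.exp_pos _).le]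
    exact mul_le_of_le_one_left hnn (div_self_le_one _)
  have hfg : ∀ z, f z * g z = ((M * K * (scaledModulus g M K z * H z) : ℝ) : ℂ) := fun z => by
    have h1 : starRingEnd ℂ (g z) / (‖g z‖ : ℂ) * g z = (‖g z‖ : ℂ) := by
      by_cases h0 : g z = 0
      · simp [h0]
      · have : (‖g z‖ : ℂ) ≠ 0 := by simpa using h0
        rw [div_mul_eq_mul_div, mul_comm, Complex.mul_conj, Complex.normSq_eq_norm_sq]
        push_cast
        field_simp
    have h2 : M * K * (scaledModulus g M K z * H z) =
        ‖g z‖ * (H z * Real.exp (‖z‖ ^ 2)) := by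
      unfold scaledModulus
      field_simp
    have h3 : f z * g z = starRingEnd ℂ (g z) / (‖g z‖ : ℂ) * g z *
        ((H z * Real.exp (‖z‖ ^ 2) : ℝ) : ℂ) := by
      simp only [hf]; ring
    rw [h3, h1, h2, ← Complex.ofReal_mul]
  have hJ0 : ∀ z, 0 ≤ scaledModulus g M K z * H z := fun z =>
    mul_nonneg (scaledModulus_nonneg hM hK0 z) (H0 z)
  have hfgi : Integrable (fun z => f z * g z) :=
    hg.bdd_mul hfm.aestronglyMeasurable (Filter.Eventually.of_forall fun z => (hfn z).trans (Hb z))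
  have hJi : Integrable (fun z => scaledModulus g M K z * H z) := by
    refine (hfgi.norm.const_mul (M * K)⁻¹).congr (Filter.Eventually.of_forall fun z => ?_)
    simp only [hfg]
    rw [Complex.norm_real, Real.norm_of_nonneg (mul_nonneg (by positivity) (hJ0 z))]
    field_simp
  set J := ∫ z, scaledModulus g M K z * H z with hJ
  have hJnn : 0 ≤ J := integral_nonneg hJ0
  rw [← ofReal_integral_eq_lintegral_ofReal hJi (Filter.Eventually.of_forall hJ0), ← hJ]
  refine ENNReal.ofReal_le_ofReal ?_
  have hmod : modular p f ≤ ENNReal.ofReal (J / D) := by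
    have h1 : rawModular p f ≤ ENNReal.ofReal J := by
      rw [hJ, ofReal_integral_eq_lintegral_ofReal hJi (Filter.Eventually.of_forall hJ0)]
      refine lintegral_mono fun z => le_trans (power_mono ?_) (hH z)
      rw [← ofReal_norm, ← ENNReal.ofReal_mul (norm_nonneg _)]
      refine ENNReal.ofReal_le_ofReal ?_
      calc ‖f z‖ * Real.exp (-‖z‖ ^ 2)
          ≤ H z * Real.exp (‖z‖ ^ 2) * Real.exp (-‖z‖ ^ 2) := by gcongr; exact hfn z
        _ = H z := by rw [mul_assoc, ← Real.exp_add]; simp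
    rw [modular, ← ENNReal.ofReal_toReal (gaussConst_ne_top p), ← hD,
      ← ENNReal.ofReal_inv_of_pos hC, div_eq_inv_mul, ENNReal.ofReal_mul (by positivity)]
    gcongr
  -- Convexity gives $\rho(f/t)\le\rho(f)/t$ only for $t\ge1$, hence the maximum.
  set t := max 1 (J / D) with ht
  have ht1 : 1 ≤ t := le_max_left _ _
  have ht0 : 0 < t := by positivity
  have hmod1 : modular p (fun z => f z / (t : ℂ)) ≤ 1 := by
    have h1 := modular_scale p hfm.aestronglyMeasurable (inv_nonneg.2 ht0.le)
      (inv_le_one_of_one_le₀ ht1)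
    have e : (fun z => f z / (t : ℂ)) = fun z => ((t⁻¹ : ℝ) : ℂ) * f z := by
      funext z; push_cast; rw [div_eq_inv_mul]
    rw [e]
    refine h1.trans ((mul_le_mul_right hmod _).trans ?_)
    rw [← ENNReal.ofReal_mul (by positivity), ← ENNReal.ofReal_one]
    refine ENNReal.ofReal_le_ofReal ?_
    rw [inv_mul_le_iff₀ ht0, mul_one]
    exact le_max_right _ _
  have hfin := hb f hfm ⟨c, fun z => (hfn z).trans (Hb z)⟩ t ht0 hmod1
  simp only [hfg] at hfin
  rw [integral_complex_ofReal, integral_const_mul, ← hJ, Complex.norm_real,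
    Real.norm_of_nonneg (by positivity), mul_assoc] at hfin
  have hKJ : K * J ≤ t := le_of_mul_le_mul_left hfin hM
  rw [← one_div, le_div_iff₀ hK0, mul_comm]
  rcases le_total (J / D) 1 with h | h
  · rwa [ht, max_eq_left h] at hKJ
  · rw [ht, max_eq_right h, div_eq_inv_mul] at hKJ
    have hJpos : 0 < J := hC.trans_le ((one_le_div hC).1 h)
    exact absurd hKJ (not_le.2 (mul_lt_mul_of_pos_right hK hJpos))

open Classical in
/-- The test moduli used to recover the conjugate modular. -/
def testModulus (p' : VariableExponent) (G : ℂ → ℝ) (n : ℕ) (z : ℂ) : ℝ :=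
  if Real.exp (‖z‖ ^ 2) ≤ n then
    if p' z = ∞ then (if G z ≤ 1 then 0 else n) else min (n : ℝ) (G z ^ ((p' z).toReal - 1))
  else 0

lemma testModulus_nonneg {G : ℂ → ℝ} (hG : ∀ z, 0 ≤ G z) (n : ℕ) (z : ℂ) :
    0 ≤ testModulus p' G n z := by
  unfold testModulus
  have := hG z
  split_ifs <;> positivity

lemma testModulus_le {G : ℂ → ℝ} (n : ℕ) (z : ℂ) : testModulus p' G n z ≤ n := by
  unfold testModulus
  split_ifs <;> first | positivity | exact le_rfl | exact min_le_left _ _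

lemma testModulus_mul_exp_le {G : ℂ → ℝ} (n : ℕ) (z : ℂ) :
    testModulus p' G n z * Real.exp (‖z‖ ^ 2) ≤ n * n := by
  by_cases h : Real.exp (‖z‖ ^ 2) ≤ n
  · exact mul_le_mul (testModulus_le n z) h (Real.exp_pos _).le (by positivity)
  · rw [testModulus, if_neg h, zero_mul]
    positivity

lemma measurable_testModulus {G : ℂ → ℝ} (hG : Measurable G) (n : ℕ) :
    Measurable (testModulus p' G n) := by
  have hq := p'.measurable_toFun
  unfold testModulus
  refine Measurable.ite (measurableSet_le (by fun_prop) measurable_const) ?_ measurable_const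
  refine Measurable.ite (hq (measurableSet_singleton _)) ?_ ?_
  · exact Measurable.ite (measurableSet_le hG measurable_const) measurable_const measurable_const
  · exact measurable_const.min (hG.pow (by fun_prop))

lemma monotone_testModulus {G : ℂ → ℝ} (hG : ∀ z, 0 ≤ G z) (z : ℂ) :
    Monotone fun n => testModulus p' G n z := by
  intro m n hmn
  have hmn' : (m : ℝ) ≤ n := by exact_mod_cast hmn
  by_cases hm : Real.exp (‖z‖ ^ 2) ≤ m
  · simp only [testModulus, if_pos hm, if_pos (hm.trans hmn')]
    split_ifs
    · exact le_rfl
    · exact hmn'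
    · exact min_le_min_right _ hmn'
  · simp only [testModulus, if_neg hm]
    exact testModulus_nonneg hG n z

/-- For finite $p'$, $H\le G^{p'-1}$ and $(p-1)(p'-1)=1$ give $H^{p-1}\le G$. Where $p=1$ and
$p'=\infty$, a nonzero $H$ occurs only where $G>1$, so $H\le GH$. -/
lemma power_testModulus_le (hp : ∀ z, p z < ∞) (hpp' : ∀ z, (p z)⁻¹ + (p' z)⁻¹ = 1)
    {G : ℂ → ℝ} (hG : ∀ z, 0 ≤ G z) (n : ℕ) (z : ℂ) :
    power (p z) (ENNReal.ofReal (testModulus p' G n z)) ≤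
      ENNReal.ofReal (G z * testModulus p' G n z) := by
  have hT := testModulus_nonneg (p' := p') hG n z
  by_cases hz : testModulus p' G n z = 0
  · simp [hz, power_zero (p.one_le z)]
  have hT' : 0 < testModulus p' G n z := lt_of_le_of_ne hT (Ne.symm hz)
  simp only [power, (hp z).ne, if_false]
  rw [ENNReal.ofReal_rpow_of_nonneg hT ENNReal.toReal_nonneg]
  refine ENNReal.ofReal_le_ofReal ?_
  have hexp : Real.exp (‖z‖ ^ 2) ≤ n := by
    by_contra h
    exact hz (by rw [testModulus, if_neg h])
  rcases ENNReal.eq_one_or_toReal_holderConjugate (hp z).ne (hpp' z) with ⟨h1, h2⟩ | ⟨-, h2, h3⟩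
  · have hG1 : ¬ G z ≤ 1 := fun h => hz (by rw [testModulus, if_pos hexp, if_pos h2, if_pos h])
    rw [h1, ENNReal.toReal_one, Real.rpow_one]
    exact le_mul_of_one_le_left hT (not_le.1 hG1).le
  · have hle : testModulus p' G n z ≤ G z ^ ((p' z).toReal - 1) := by
      rw [testModulus, if_pos hexp, if_neg h2]
      exact min_le_right _ _
    have hstep : testModulus p' G n z ^ ((p z).toReal - 1) ≤ G z := by
      calc _ ≤ (G z ^ ((p' z).toReal - 1)) ^ ((p z).toReal - 1) :=
            Real.rpow_le_rpow hT hle h3.sub_one_pos.le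
        _ = G z := by
          rw [← Real.rpow_mul (hG z)]
          have : ((p' z).toReal - 1) * ((p z).toReal - 1) = 1 := by
            have := h3.sub_one_mul_conj
            have := h3.mul_eq_add
            nlinarith
          rw [this, Real.rpow_one]
    calc testModulus p' G n z ^ (p z).toReal
        = testModulus p' G n z ^ ((p z).toReal - 1) * testModulus p' G n z := by
          rw [← Real.rpow_add_one hT'.ne']; ring_nf
      _ ≤ _ := by gcongr

/-- For finite $p'$ both truncations are inactive for large $n$, and $G\cdot G^{p'-1}=G^{p'}$. For
$p'=\infty$ and $G>1$ the products are eventually at least $n$, matching the value $\infty$. -/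
lemma power_le_iSup_testModulus (hp : ∀ z, p z < ∞) (hpp' : ∀ z, (p z)⁻¹ + (p' z)⁻¹ = 1)
    {G : ℂ → ℝ} (hG : ∀ z, 0 ≤ G z) (z : ℂ) :
    power (p' z) (ENNReal.ofReal (G z)) ≤
      ⨆ n, ENNReal.ofReal (G z * testModulus p' G n z) := by
  obtain ⟨N, hN⟩ := exists_nat_ge (Real.exp (‖z‖ ^ 2))
  rcases ENNReal.eq_one_or_toReal_holderConjugate (hp z).ne (hpp' z) with ⟨-, h2⟩ | ⟨-, h2, h3⟩
  · by_cases h1 : G z ≤ 1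
    · have : ENNReal.ofReal (G z) ≤ 1 := by simpa using h1
      simp [power, h2, this]
    · refine le_of_forall_lt fun a ha => ?_
      obtain ⟨m, hm⟩ := ENNReal.exists_nat_gt (ha.trans_le le_top).ne
      refine hm.trans_le (le_trans ?_ (le_iSup _ (max N m)))
      have hmx : Real.exp (‖z‖ ^ 2) ≤ ((max N m : ℕ) : ℝ) :=
        hN.trans (by exact_mod_cast le_max_left _ _)
      rw [testModulus, if_pos hmx, if_pos h2, if_neg h1, ← ENNReal.ofReal_natCast]
      refine ENNReal.ofReal_le_ofReal ?_
      calc (m : ℝ) ≤ ((max N m : ℕ) : ℝ) := by exact_mod_cast le_max_right _ _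
        _ ≤ _ := le_mul_of_one_le_left (by positivity) (not_le.1 h1).le
  · obtain ⟨m, hm⟩ := exists_nat_ge (G z ^ ((p' z).toReal - 1))
    refine le_trans (le_of_eq ?_) (le_iSup _ (max N m))
    have hmx : Real.exp (‖z‖ ^ 2) ≤ ((max N m : ℕ) : ℝ) :=
      hN.trans (by exact_mod_cast le_max_left _ _)
    have hmx' : G z ^ ((p' z).toReal - 1) ≤ ((max N m : ℕ) : ℝ) :=
      hm.trans (by exact_mod_cast le_max_right _ _)
    rw [testModulus, if_pos hmx, if_neg h2, min_eq_right hmx', power, if_neg h2,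
      ENNReal.ofReal_rpow_of_nonneg (hG z) ENNReal.toReal_nonneg]
    congr 1
    rcases (hG z).eq_or_lt with h0 | h0
    · rw [← h0, zero_mul, Real.zero_rpow h3.symm.ne_zero]
    · rw [mul_comm, ← Real.rpow_add_one h0.ne']; ring_nf

/-- The conjugate modular is controlled by the pairing with bounded functions. -/
lemma lintegral_power_scaledModulus_le (hp : ∀ z, p z < ∞)
    (hpp' : ∀ z, (p z)⁻¹ + (p' z)⁻¹ = 1) (hgm : Measurable g) (hg : Integrable g)
    (hM : 0 < M) (hK : (gaussConst p).toReal⁻¹ < K) (hb : PairingBound p g M) :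
    ∫⁻ z, power (p' z) (ENNReal.ofReal (scaledModulus g M K z)) ≤ ENNReal.ofReal K⁻¹ := by
  have hK0 : 0 < K := lt_of_le_of_lt (by positivity) hK
  have hG0 : ∀ z, 0 ≤ scaledModulus g M K z := scaledModulus_nonneg hM hK0
  have hGm : Measurable (scaledModulus g M K) := by unfold scaledModulus; fun_prop
  refine (lintegral_mono (power_le_iSup_testModulus hp hpp' hG0)).trans ?_
  -- Monotone convergence: the test moduli increase with $n$, and each is bounded by the same $1/K$.
  rw [lintegral_iSup]
  · exact iSup_le fun n => lintegral_le_inv_of_test hp hgm hg hM hK hb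
      (measurable_testModulus hGm n) (testModulus_nonneg hG0 n)
      (testModulus_mul_exp_le n) (power_testModulus_le hp hpp' hG0 n)
  · exact fun n => (hGm.mul (measurable_testModulus hGm n)).ennreal_ofReal
  · intro m n hmn z
    exact ENNReal.ofReal_le_ofReal
      (mul_le_mul_of_nonneg_left (monotone_testModulus hG0 z hmn) (hG0 z))

/-- The constant in the norm-conjugate estimate. -/
def conjConst (p p' : VariableExponent) : ℝ :=
  (gaussConst p).toReal⁻¹ + (gaussConst p').toReal⁻¹ + 1

lemma conjConst_pos (p p' : VariableExponent) : 0 < conjConst p p' := by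
  unfold conjConst; positivity

/-- `conjConst` is a value of $K$ satisfying both $K>1/C_p$, needed for the test argument, and
$1/K\le C_{p'}$ when $C_{p'}\ne0$, which turns the bound on the integral into modular at most $1$.
-/
lemma modular_conj_le_one (hp : ∀ z, p z < ∞) (hpp' : ∀ z, (p z)⁻¹ + (p' z)⁻¹ = 1)
    (hgm : Measurable g) (hg : Integrable g) (hM : 0 < M) (hb : PairingBound p g M) :
    modular p' (fun z => g z * (Real.exp (2 * ‖z‖ ^ 2) : ℂ) /
      ((M * conjConst p p' : ℝ) : ℂ)) ≤ 1 := by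
  set K := conjConst p p' with hKdef
  have hK0 : 0 < K := conjConst_pos p p'
  have hK : (gaussConst p).toReal⁻¹ < K := by
    have : 0 ≤ (gaussConst p').toReal⁻¹ := by positivity
    rw [hKdef, conjConst]; linarith
  have hmain := lintegral_power_scaledModulus_le hp hpp' hgm hg hM hK hb
  have hpt : ∀ z, ‖g z * (Real.exp (2 * ‖z‖ ^ 2) : ℂ) / ((M * K : ℝ) : ℂ)‖ₑ *
      ENNReal.ofReal (Real.exp (-‖z‖ ^ 2)) = ENNReal.ofReal (scaledModulus g M K z) := fun z => by
    rw [← ofReal_norm, ← ENNReal.ofReal_mul (norm_nonneg _), norm_div, norm_mul,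
      Complex.norm_real, Complex.norm_real, Real.norm_of_nonneg (Real.exp_pos _).le,
      Real.norm_of_nonneg (by positivity), scaledModulus, div_mul_eq_mul_div, mul_assoc,
      ← Real.exp_add]
    ring_nf
  have hraw : rawModular p' (fun z => g z * (Real.exp (2 * ‖z‖ ^ 2) : ℂ) / ((M * K : ℝ) : ℂ)) =
      ∫⁻ z, power (p' z) (ENNReal.ofReal (scaledModulus g M K z)) :=
    lintegral_congr fun z => by rw [hpt]
  rw [modular, hraw]
  -- If $C_{p'}=0$ then $p'=\infty$ almost everywhere. The integrand takes only the values $0$ and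
  -- $\infty$ there, so its finite integral must be $0$.
  by_cases h0 : gaussConst p' = 0
  · have hm := aemeasurable_integrand p' (f := fun _ => 1) aestronglyMeasurable_const
    simp only [enorm_one, one_mul] at hm
    have htop : ∀ᵐ z, p' z = ∞ := by
      filter_upwards [(lintegral_eq_zero_iff' hm).1 h0] with z hz
      by_contra h
      simp [power, h] at hz
      exact absurd hz.1 (not_le.2 (Real.exp_pos _))
    have hm' : AEMeasurable (fun z => power (p' z) (ENNReal.ofReal (scaledModulus g M K z))) := by
      have := aemeasurable_integrand p'
        (f := fun z => g z * (Real.exp (2 * ‖z‖ ^ 2) : ℂ) / ((M * K : ℝ) : ℂ))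
        (Measurable.aestronglyMeasurable (by fun_prop))
      simpa only [hpt] using this
    have hz : ∫⁻ z, power (p' z) (ENNReal.ofReal (scaledModulus g M K z)) = 0 := by
      rw [lintegral_eq_zero_iff' hm']
      filter_upwards [htop, ae_lt_top' hm' (hmain.trans_lt ENNReal.ofReal_lt_top).ne]
        with z h1 h2
      simp only [power, h1, if_true] at h2 ⊢
      split_ifs at h2 ⊢ <;> simp_all
    rw [hz, mul_zero]
    exact zero_le_one
  · rw [ENNReal.inv_mul_le_iff h0 (gaussConst_ne_top p'), mul_one]
    refine hmain.trans ?_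
    have hC : 0 < (gaussConst p').toReal := ENNReal.toReal_pos h0 (gaussConst_ne_top p')
    rw [← ENNReal.ofReal_toReal (gaussConst_ne_top p')]
    refine ENNReal.ofReal_le_ofReal ?_
    rw [inv_le_comm₀ hK0 hC]
    have : 0 ≤ (gaussConst p).toReal⁻¹ := by positivity
    rw [hKdef, conjConst]; linarith

lemma modular_congr_norm (q : VariableExponent) {f g : ℂ → ℂ} (h : ∀ᵐ z, ‖f z‖ = ‖g z‖) :
    modular q f = modular q g := by
  unfold modular rawModular
  congr 1
  refine lintegral_congr_ae ?_
  filter_upwards [h] with z hz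
  rw [← ofReal_norm, hz, ofReal_norm]

end VariableExponent

/-! ### Conjugation, the Gaussian pairing and representation of functionals -/

namespace GaussianLp

variable {p p' q : VariableExponent}

open Filter Topology

/-- Pointwise complex conjugation on `𝓛^{q(·)}`. -/
def conj (f : GaussianLp q) : GaussianLp q :=
  ⟨star (f : ℂ →ₘ[volume] ℂ), by
    obtain ⟨t, ht, h⟩ := f.2
    refine ⟨t, ht, lt_of_le_of_lt (le_of_eq (modular_congr_norm q ?_)) h⟩
    filter_upwards [AEEqFun.coeFn_star (f : ℂ →ₘ[volume] ℂ)] with z hz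
    rw [hz, Pi.star_apply, norm_mul, norm_mul, norm_star]⟩

lemma coeFn_conj (f : GaussianLp q) :
    (conj f : ℂ →ₘ[volume] ℂ) =ᵐ[volume]
      fun z => starRingEnd ℂ ((f : ℂ →ₘ[volume] ℂ) z) :=
  AEEqFun.coeFn_star _

lemma conj_conj (f : GaussianLp q) : conj (conj f) = f :=
  Subtype.ext (star_star _)

lemma norm_conj (f : GaussianLp q) : ‖conj f‖ = ‖f‖ := by
  simp only [norm_def, luxNorm]
  congr 1
  ext t
  refine and_congr_right fun _ => ?_
  rw [modular_congr_norm q]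
  filter_upwards [coeFn_conj f] with z hz
  rw [hz, norm_div, norm_div, RCLike.norm_conj]

/-- Conjugation as a conjugate-linear homeomorphism. -/
def conjEquiv (q : VariableExponent) : GaussianLp q ≃L⋆[ℂ] GaussianLp q :=
  LinearEquiv.toContinuousLinearEquivOfBounds
    { toFun := conj
      invFun := conj
      left_inv := conj_conj
      right_inv := conj_conj
      map_add' := fun f g => ext_ae <| by
        filter_upwards [coeFn_conj (f + g), coeFn_add' f g, coeFn_add' (conj f) (conj g),
          coeFn_conj f, coeFn_conj g] with z h1 h2 h3 h4 h5
        rw [h1, h2, h3, h4, h5, map_add]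
      map_smul' := fun c f => ext_ae <| by
        filter_upwards [coeFn_conj (c • f), coeFn_smul' c f,
          coeFn_smul' (starRingEnd ℂ c) (conj f), coeFn_conj f] with z h1 h2 h3 h4
        rw [h1, h2, h3, h4, map_mul] }
    1 1 (fun f => by rw [one_mul]; exact (norm_conj f).le)
    (fun f => by rw [one_mul]; exact (norm_conj f).le)

lemma conjEquiv_apply (f : GaussianLp q) : conjEquiv q f = conj f := rfl

/-- The bilinear Gaussian pairing `f ↦ (2/π) ∫ f h e^{-2|z|²}` as a bounded functional. -/
def pairing (hp : ∀ z, p z < ∞) (hpp' : ∀ z, (p z)⁻¹ + (p' z)⁻¹ = 1) (h : GaussianLp p') :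
    StrongDual ℂ (GaussianLp p) :=
  LinearMap.mkContinuous
    { toFun := fun f => 2 / (Real.pi : ℂ) * ∫ z, (f : ℂ →ₘ[volume] ℂ) z *
        (h : ℂ →ₘ[volume] ℂ) z * (Real.exp (-2 * ‖z‖ ^ 2) : ℂ)
      map_add' := fun f g => by
        rw [← mul_add, ← integral_add (integrable_pairing hp hpp' f h)
          (integrable_pairing hp hpp' g h)]
        refine congrArg (fun x => 2 / (Real.pi : ℂ) * x) (integral_congr_ae ?_)
        filter_upwards [coeFn_add' f g] with z hz
        rw [hz]; ring
      map_smul' := fun c f => by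
        rw [RingHom.id_apply, smul_eq_mul, mul_left_comm c, ← integral_const_mul c]
        refine congrArg (fun x => 2 / (Real.pi : ℂ) * x) (integral_congr_ae ?_)
        filter_upwards [coeFn_smul' c f] with z hz
        rw [hz]; ring }
    (2 / Real.pi * ((gaussConst p).toReal + (gaussConst p').toReal) * ‖h‖) fun f => by
      have h1 := norm_integral_pairing_le hp hpp' f h
      have h2 : ‖(2 / (Real.pi : ℂ))‖ = 2 / Real.pi := by
        rw [norm_div, Complex.norm_real, Real.norm_of_nonneg Real.pi_pos.le]; simp
      simp only [LinearMap.coe_mk, AddHom.coe_mk]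
      rw [norm_mul, h2, mul_assoc, mul_assoc]
      refine mul_le_mul_of_nonneg_left ?_ (by positivity)
      rwa [mul_assoc] at h1

lemma pairing_apply (hp : ∀ z, p z < ∞) (hpp' : ∀ z, (p z)⁻¹ + (p' z)⁻¹ = 1)
    (h : GaussianLp p') (f : GaussianLp p) :
    pairing hp hpp' h f = 2 / (Real.pi : ℂ) * ∫ z, (f : ℂ →ₘ[volume] ℂ) z *
        (h : ℂ →ₘ[volume] ℂ) z * (Real.exp (-2 * ‖z‖ ^ 2) : ℂ) := rfl

lemma norm_pairing_le (hp : ∀ z, p z < ∞) (hpp' : ∀ z, (p z)⁻¹ + (p' z)⁻¹ = 1)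
    (h : GaussianLp p') : ‖pairing hp hpp' h‖ ≤
      2 / Real.pi * ((gaussConst p).toReal + (gaussConst p').toReal) * ‖h‖ :=
  LinearMap.mkContinuous_norm_le _ (by have := norm_nonneg h; positivity) _

lemma exp_neg_two_mul_exp_two (z : ℂ) :
    (Real.exp (-2 * ‖z‖ ^ 2) : ℂ) * (Real.exp (2 * ‖z‖ ^ 2) : ℂ) = 1 := by
  rw [← Complex.ofReal_mul, ← Real.exp_add]
  simp

lemma two_div_pi_mul : (2 / (Real.pi : ℂ)) * ((Real.pi : ℂ) / 2) = 1 := by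
  have : (Real.pi : ℂ) ≠ 0 := by exact_mod_cast Real.pi_ne_zero
  field_simp

lemma pairingBound_of_dual (φ : StrongDual ℂ (GaussianLp p)) {g : ℂ → ℂ} {M : ℝ}
    (hM : ‖φ‖ ≤ M) (hg : ∀ (f : GaussianLp p) (c : ℝ),
      (∀ᵐ z, ‖(f : ℂ →ₘ[volume] ℂ) z‖ ≤ c) → φ f = ∫ z, (f : ℂ →ₘ[volume] ℂ) z * g z) :
    PairingBound p g M := by
  rintro f hf ⟨c, hc⟩ t ht hmod
  let u : GaussianLp p := mk f hf.aestronglyMeasurable ht hmod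
  have hu : (u : ℂ →ₘ[volume] ℂ) =ᵐ[volume] f := coeFn_mk _ _ _ _
  have hφ : φ u = ∫ z, f z * g z := by
    rw [hg u c (hu.mono fun z hz => by rw [hz]; exact hc z)]
    exact integral_congr_ae (hu.mono fun z hz => by simp only [hz])
  rw [← hφ]
  exact (φ.le_of_opNorm_le hM u).trans
    (mul_le_mul_of_nonneg_left (norm_mk_le _ _ _ _) ((norm_nonneg φ).trans hM))

/-- The functional of $h$ has density $g=\frac2\pi h\,e^{-2|z|^2}$. The conjugate estimate controls
$g\,e^{2|z|^2}=\frac2\pi h$, whence the factor $\pi/2$. -/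
lemma norm_le_norm_pairing (hp : ∀ z, p z < ∞) (hpp' : ∀ z, (p z)⁻¹ + (p' z)⁻¹ = 1)
    (h : GaussianLp p') :
    ‖h‖ ≤ Real.pi / 2 * conjConst p p' * ‖pairing hp hpp' h‖ := by
  have hK := conjConst_pos p p'
  have hpi := Real.pi_pos
  have hpiC : (Real.pi : ℂ) ≠ 0 := by exact_mod_cast hpi.ne'
  have hφ0 := norm_nonneg (pairing hp hpp' h)
  have hhm := (h : ℂ →ₘ[volume] ℂ).stronglyMeasurable.measurable
  set g : ℂ → ℂ := fun z => 2 / (Real.pi : ℂ) *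
    ((h : ℂ →ₘ[volume] ℂ) z * (Real.exp (-2 * ‖z‖ ^ 2) : ℂ)) with hgdef
  have hgm : Measurable g := by fun_prop
  -- Constants lie in $\mathcal L^{p(\cdot)}$, so pairing $h$ with the function $1$ gives
  -- integrability.
  have hg : Integrable g := by
    refine ((integrable_pairing hp hpp' (indicatorOne p Set.univ) h).const_mul
      (2 / (Real.pi : ℂ))).congr ?_
    filter_upwards [coeFn_indicatorOne (q := p) MeasurableSet.univ] with z hz
    simp [hz, hgdef]
  have key : ∀ ε : ℝ, 0 < ε →
      ‖h‖ ≤ Real.pi / 2 * conjConst p p' * (‖pairing hp hpp' h‖ + ε) := by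
    intro ε hε
    -- Adding $\varepsilon$ keeps $M$ positive even when the functional is zero, which is the case
    -- that yields injectivity.
    set M := ‖pairing hp hpp' h‖ + ε
    have hM : 0 < M := by positivity
    have hb : PairingBound p g M := pairingBound_of_dual (pairing hp hpp' h)
      (by simp only [M]; linarith) fun f c _ => by
        rw [pairing_apply, ← integral_const_mul]
        refine integral_congr_ae (Eventually.of_forall fun z => ?_)
        simp only [hgdef]; ring
    refine norm_le_of_modular h (by positivity) ?_
    refine le_trans (le_of_eq ?_) (modular_conj_le_one hp hpp' hgm hg hM hb)
    refine modular_congr p' (Eventually.of_forall fun z => ?_)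
    have hKC : (conjConst p p' : ℂ) ≠ 0 := by exact_mod_cast hK.ne'
    have hMC : (M : ℂ) ≠ 0 := by exact_mod_cast hM.ne'
    have e := exp_neg_two_mul_exp_two z
    simp only [hgdef]
    rw [mul_assoc (2 / (Real.pi : ℂ)), mul_assoc ((h : ℂ →ₘ[volume] ℂ) z), e]
    push_cast
    field_simp
  have hcont : Tendsto (fun ε : ℝ => Real.pi / 2 * conjConst p p' * (‖pairing hp hpp' h‖ + ε))
      (𝓝[>] 0) (𝓝 (Real.pi / 2 * conjConst p p' * ‖pairing hp hpp' h‖)) := by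
    have : Continuous fun ε : ℝ =>
      Real.pi / 2 * conjConst p p' * (‖pairing hp hpp' h‖ + ε) := by fun_prop
    simpa using (this.tendsto 0).mono_left nhdsWithin_le_nhds
  exact ge_of_tendsto hcont (eventually_of_mem self_mem_nhdsWithin key)

/-- Bounded functions are dense: functionals that agree on them are equal. -/
lemma dual_ext_of_bounded (hp : p.IsBounded) {φ ψ : StrongDual ℂ (GaussianLp p)}
    (h : ∀ (f : GaussianLp p) (c : ℝ), (∀ᵐ z, ‖(f : ℂ →ₘ[volume] ℂ) z‖ ≤ c) → φ f = ψ f) :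
    φ = ψ := by
  ext f
  have hfm := (f : ℂ →ₘ[volume] ℂ).stronglyMeasurable.measurable
  -- Cutting $f$ off where $|f|>n$ gives bounded functions whose error is dominated by $|f|$ itself.
  let A : ℕ → Set ℂ := fun n => {z | ‖(f : ℂ →ₘ[volume] ℂ) z‖ ≤ n}
  have hA : ∀ n, MeasurableSet (A n) := fun n => measurableSet_le hfm.norm measurable_const
  have hbd : ∀ n z, ‖(A n).indicator (f : ℂ →ₘ[volume] ℂ) z‖ ≤ (n : ℝ) + 1 := fun n z => by
    by_cases hz : z ∈ A n
    · rw [Set.indicator_of_mem hz]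
      exact le_trans hz (by linarith)
    · rw [Set.indicator_of_notMem hz, norm_zero]
      positivity
  let u : ℕ → GaussianLp p := fun n => ofBounded ((A n).indicator (f : ℂ →ₘ[volume] ℂ))
    (hfm.indicator (hA n)).aestronglyMeasurable (c := (n : ℝ) + 1) (by positivity) (hbd n)
  have hu : ∀ n, (u n : ℂ →ₘ[volume] ℂ) =ᵐ[volume] (A n).indicator (f : ℂ →ₘ[volume] ℂ) :=
    fun n => coeFn_ofBounded _ _ _ _
  have hsub : ∀ᵐ z, ∀ n, ((u n - f : GaussianLp p) : ℂ →ₘ[volume] ℂ) z =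
      (A n).indicator (f : ℂ →ₘ[volume] ℂ) z - (f : ℂ →ₘ[volume] ℂ) z := by
    rw [ae_all_iff]
    intro n
    filter_upwards [coeFn_sub' (u n) f, hu n] with z h1 h2
    rw [h1, h2]
  have hconv : Tendsto u atTop (𝓝 f) := by
    rw [tendsto_iff_norm_sub_tendsto_zero]
    refine tendsto_norm_zero_of_dominated hp _ f (Eventually.of_forall fun n => ?_) ?_
    · filter_upwards [hsub] with z h1
      rw [h1 n]
      by_cases hz : z ∈ A n
      · rw [Set.indicator_of_mem hz, sub_self, norm_zero]; positivity
      · rw [Set.indicator_of_notMem hz, zero_sub, norm_neg]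
    · filter_upwards [hsub] with z h1
      simp only [h1]
      obtain ⟨N, hN⟩ := exists_nat_ge ‖(f : ℂ →ₘ[volume] ℂ) z‖
      refine tendsto_const_nhds.congr' ?_
      filter_upwards [eventually_ge_atTop N] with n hn
      have hz : z ∈ A n := hN.trans (by exact_mod_cast hn)
      rw [Set.indicator_of_mem hz, sub_self]
  have h1 : Tendsto (fun n => φ (u n)) atTop (𝓝 (φ f)) := (φ.continuous.tendsto f).comp hconv
  have h2 : Tendsto (fun n => ψ (u n)) atTop (𝓝 (ψ f)) := (ψ.continuous.tendsto f).comp hconv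
  refine tendsto_nhds_unique h1 (h2.congr fun n => (h (u n) (n + 1) ?_).symm)
  exact (hu n).mono fun z hz => by rw [hz]; exact hbd n z

/-- The density of $\varphi$ on bounded functions is only known to be in $L^1$; the conjugate
estimate upgrades $\frac\pi2 g\,e^{2|z|^2}$ to an element of $\mathcal L^{p'(\cdot)}$. Its
functional agrees with $\varphi$ on bounded functions, hence everywhere by density. -/
lemma exists_pairing_eq (hp : p.IsBounded) (hpp' : ∀ z, (p z)⁻¹ + (p' z)⁻¹ = 1)
    (φ : StrongDual ℂ (GaussianLp p)) : ∃ h : GaussianLp p', pairing hp.1 hpp' h = φ := by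
  obtain ⟨g₀, hg₀, hgφ₀⟩ := exists_density_bounded hp φ
  -- The test functions are built pointwise from $g$, so a genuinely measurable representative is
  -- taken.
  set g := hg₀.1.mk g₀
  have hgm : Measurable g := hg₀.1.stronglyMeasurable_mk.measurable
  have hgae : g₀ =ᵐ[volume] g := hg₀.1.ae_eq_mk
  have hg : Integrable g := hg₀.congr hgae
  have hgφ : ∀ (f : GaussianLp p) (c : ℝ), (∀ᵐ z, ‖(f : ℂ →ₘ[volume] ℂ) z‖ ≤ c) →
      φ f = ∫ z, (f : ℂ →ₘ[volume] ℂ) z * g z := fun f c hc => by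
    rw [hgφ₀ f c hc]
    exact integral_congr_ae (hgae.mono fun z hz => by simp only [hz])
  have hK := conjConst_pos p p'
  have hpi := Real.pi_pos
  have hpiC : (Real.pi : ℂ) ≠ 0 := by exact_mod_cast hpi.ne'
  -- Only membership in the space is at stake here, so any positive bound for $\|\varphi\|$ serves.
  set M := ‖φ‖ + 1 with hMdef
  have hM : 0 < M := by positivity
  have hmod := modular_conj_le_one hp.1 hpp' hgm hg hM
    (pairingBound_of_dual φ (by linarith) hgφ)
  let k : ℂ → ℂ := fun z => (Real.pi : ℂ) / 2 * (g z * (Real.exp (2 * ‖z‖ ^ 2) : ℂ))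
  have hkm : Measurable k := by fun_prop
  have hkmod : modular p' (fun z => k z / ((Real.pi / 2 * (M * conjConst p p') : ℝ) : ℂ)) ≤ 1 := by
    refine le_trans (le_of_eq (modular_congr p' (Eventually.of_forall fun z => ?_))) hmod
    have hKC : (conjConst p p' : ℂ) ≠ 0 := by exact_mod_cast hK.ne'
    have hMC : (M : ℂ) ≠ 0 := by exact_mod_cast hM.ne'
    simp only [k]
    push_cast
    field_simp
  let h : GaussianLp p' := mk k hkm.aestronglyMeasurable (by positivity) hkmod
  have hh : (h : ℂ →ₘ[volume] ℂ) =ᵐ[volume] k := coeFn_mk _ _ _ _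
  refine ⟨h, dual_ext_of_bounded hp fun f c hc => ?_⟩
  rw [hgφ f c hc, pairing_apply, ← integral_const_mul]
  refine integral_congr_ae (hh.mono fun z hz => ?_)
  have e := exp_neg_two_mul_exp_two z
  have e' := two_div_pi_mul
  simp only [hz, k]
  linear_combination (2 / (Real.pi : ℂ)) * (Real.pi / 2) * (f : ℂ →ₘ[volume] ℂ) z * g z * e +
    (f : ℂ →ₘ[volume] ℂ) z * g z * e'

/-- The bilinear pairing identifies `𝓛^{p'(·)}` with the dual of `𝓛^{p(·)}`. -/
def pairingEquiv (hp : p.IsBounded) (hpp' : ∀ z, (p z)⁻¹ + (p' z)⁻¹ = 1) :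
    GaussianLp p' ≃L[ℂ] StrongDual ℂ (GaussianLp p) :=
  let L : GaussianLp p' →ₗ[ℂ] StrongDual ℂ (GaussianLp p) :=
    { toFun := pairing hp.1 hpp'
      map_add' := fun h k => by
        ext f
        rw [_root_.add_apply, pairing_apply, pairing_apply, pairing_apply,
          ← mul_add, ← integral_add (integrable_pairing hp.1 hpp' f h)
          (integrable_pairing hp.1 hpp' f k)]
        refine congrArg (fun x => 2 / (Real.pi : ℂ) * x) (integral_congr_ae ?_)
        filter_upwards [coeFn_add' h k] with z hz
        rw [hz]; ring
      map_smul' := fun c h => by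
        ext f
        rw [RingHom.id_apply, _root_.smul_apply, pairing_apply, pairing_apply,
          smul_eq_mul, mul_left_comm c, ← integral_const_mul c]
        refine congrArg (fun x => 2 / (Real.pi : ℂ) * x) (integral_congr_ae ?_)
        filter_upwards [coeFn_smul' c h] with z hz
        rw [hz]; ring }
  have hL : Function.Bijective L := by
    refine ⟨(injective_iff_map_eq_zero L).2 fun h hh => ?_, exists_pairing_eq hp hpp'⟩
    have h1 := norm_le_norm_pairing hp.1 hpp' h
    have h2 : pairing hp.1 hpp' h = 0 := hh
    rw [h2, norm_zero, mul_zero] at h1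
    exact norm_le_zero_iff.1 h1
  LinearEquiv.toContinuousLinearEquivOfBounds (LinearEquiv.ofBijective L hL) _ _
    (norm_pairing_le hp.1 hpp') fun φ => by
      have h1 := norm_le_norm_pairing hp.1 hpp' ((LinearEquiv.ofBijective L hL).symm φ)
      have h2 : pairing hp.1 hpp' ((LinearEquiv.ofBijective L hL).symm φ) = φ :=
        (LinearEquiv.ofBijective L hL).apply_symm_apply φ
      rwa [h2] at h1

lemma pairingEquiv_apply (hp : p.IsBounded) (hpp' : ∀ z, (p z)⁻¹ + (p' z)⁻¹ = 1)
    (h : GaussianLp p') : pairingEquiv hp hpp' h = pairing hp.1 hpp' h := rfl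

end GaussianLp

end

theorem mainTheorem7 (p p' : VariableExponent) (hp : p.IsBounded)
    (hpp' : ∀ z, (p z)⁻¹ + (p' z)⁻¹ = 1) :
    Nonempty (StrongDual ℂ (GaussianLp p) ≃L[ℂ] GaussianLp p') ∧
    ∃ Φ : GaussianLp p' ≃L⋆[ℂ] StrongDual ℂ (GaussianLp p),
      (∀ (h : GaussianLp p') (f : GaussianLp p),
        MeasureTheory.Integrable (fun z : ℂ =>
          (f : ℂ →ₘ[MeasureTheory.volume] ℂ) z *
            starRingEnd ℂ ((h : ℂ →ₘ[MeasureTheory.volume] ℂ) z) *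
            (Real.exp (-2 * ‖z‖ ^ 2) : ℂ)) ∧
        Φ h f = 2 / (Real.pi : ℂ) * ∫ z : ℂ,
          (f : ℂ →ₘ[MeasureTheory.volume] ℂ) z *
            starRingEnd ℂ ((h : ℂ →ₘ[MeasureTheory.volume] ℂ) z) *
            (Real.exp (-2 * ‖z‖ ^ 2) : ℂ)) ∧
      ∃ c C : ℝ, 0 < c ∧ 0 < C ∧ ∀ h : GaussianLp p',
        c * ‖h‖ ≤ ‖Φ h‖ ∧ ‖Φ h‖ ≤ C * ‖h‖ := by
  refine ⟨⟨(GaussianLp.pairingEquiv hp hpp').symm⟩,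
    (GaussianLp.conjEquiv p').trans (GaussianLp.pairingEquiv hp hpp'), fun h f => ?_, ?_⟩
  · have hae : ∀ᵐ z, (f : ℂ →ₘ[volume] ℂ) z * (GaussianLp.conj h : ℂ →ₘ[volume] ℂ) z *
        (Real.exp (-2 * ‖z‖ ^ 2) : ℂ) = (f : ℂ →ₘ[volume] ℂ) z *
          starRingEnd ℂ ((h : ℂ →ₘ[volume] ℂ) z) * (Real.exp (-2 * ‖z‖ ^ 2) : ℂ) := by
      filter_upwards [GaussianLp.coeFn_conj h] with z hz
      rw [hz]
    refine ⟨(GaussianLp.integrable_pairing hp.1 hpp' f (GaussianLp.conj h)).congr hae, ?_⟩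
    rw [ContinuousLinearEquiv.trans_apply, GaussianLp.conjEquiv_apply,
      GaussianLp.pairingEquiv_apply, GaussianLp.pairing_apply, integral_congr_ae hae]
  · have hK := VariableExponent.conjConst_pos p p'
    have hC : 0 < (VariableExponent.gaussConst p).toReal :=
      ENNReal.toReal_pos (VariableExponent.gaussConst_ne_zero hp.1)
        (VariableExponent.gaussConst_ne_top p)
    have hpi := Real.pi_pos
    refine ⟨(Real.pi / 2 * VariableExponent.conjConst p p')⁻¹,
      2 / Real.pi * ((VariableExponent.gaussConst p).toReal +
        (VariableExponent.gaussConst p').toReal), by positivity, by positivity, fun h => ?_⟩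
    rw [ContinuousLinearEquiv.trans_apply, GaussianLp.conjEquiv_apply,
      GaussianLp.pairingEquiv_apply, ← GaussianLp.norm_conj h]
    refine ⟨?_, GaussianLp.norm_pairing_le hp.1 hpp' _⟩
    rw [inv_mul_le_iff₀ (by positivity)]
    exact GaussianLp.norm_le_norm_pairing hp.1 hpp' _
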